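/- Let $(X,\mu)$ and $(Y,\nu)$ be standard (Lebesgue--Rokhlin) probability spaces; measurability of functions is understood with respect to completed measures. A semimetric $\rho$ on a measure space is called admissible if it is measurable as a function of two variables and some subset of full measure is separable with respect to $\rho$. A measurable function $g\colon X\times Y\to\mathbb R$ is called properly virtually continuous if for every $\varepsilon>0$ there are measurable sets $X'\subset X$, $Y'\subset Y$ of measure at least $1-\varepsilon$ and admissible semimetrics $\rho_X,\rho_Y$ on $X',Y'$ (with the restricted measures) such that $g$ is continuous on $(X'\times Y',\rho_X\times\rho_Y)$. A function is virtually continuous if it coincides $\mu\times\nu$-almost everywhere with a properly virtually continuous function. Put $$\|f\|_{SR^1}=\inf\Big\{\int_X a\,d\mu+\int_Y b\,d\nu\ :\ a\ge 0,\ b\ge 0 \text{ measurable},\ |f(x,y)|\le a(x)+b(y)\ \ \mu\times\nu\text{-a.e.}\Big\}\in[0,\infty],$$ and let $VC^1$ be the normed space of virtually continuous functions $f$ with $\|f\|_{SR^1}<\infty$, modulo equality $\mu\times\nu$-a.e. Let $QB^\infty$ be the normed space of all finite signed measures $\eta$ on $X\times Y$ that are quasi-bistochastic, i.e. whose total variation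 $|\eta|$ has projections $P^x_*|\eta|\ll\mu$ and $P^y_*|\eta|\ll\nu$, and for which the norm $$\|\eta\|=\max\left\{\Big\|\frac{d P^x_*|\eta|}{d\mu}\Big\|_{L^\infty(X,\mu)},\ \Big\|\frac{d P^y_*|\eta|}{d\nu}\Big\|_{L^\infty(Y,\nu)}\right\}$$ is finite. Then the Banach dual of $VC^1$ is $QB^\infty$: for $f\in VC^1$, every properly virtually continuous function $\tilde f$ equal to $f$ $\mu\times\nu$-a.e. and every $\eta\in QB^\infty$, the function $\tilde f$ is $\eta$-integrable (i.e. measurable with respect to the completion of $|\eta|$, and $|\eta|$-integrable), the integral $\int\tilde f\,d\eta$ does not depend on the choice of $\tilde f$, and $$\eta\longmapsto\Big(f\mapsto\int_{X\times Y}\tilde f\,d\eta\Big)$$ is a linear isometric isomorphism of $QB^\infty$ onto $(VC^1)^*$. -/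

import Mathlib

open MeasureTheory TopologicalSpace
open scoped ENNReal NNReal

/-- A semimetric `ρ` on a measure space `(X, μ)` is *admissible* if it is measurable as a function
of two variables (with respect to the completion of `μ × μ`) and some subset of full measure is
separable for `ρ`. -/
def IsAdmissible {X : Type*} [MeasurableSpace X] (μ : Measure X) (ρ : PseudoMetricSpace X) :
    Prop :=
  AEMeasurable (fun p : X × X => ρ.dist p.1 p.2) (μ.prod μ) ∧
    ∃ X₀ : Set X, μ X₀ᶜ = 0 ∧ IsSeparable X₀

/-- Properly virtually continuous functions: for every `ε > 0` there are sets `X' ⊆ X`, `Y' ⊆ Y`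
of measure at least `1 - ε` with admissible semimetrics for which `f` is continuous on
`X' × Y'`. The subsets carry the restricted measures `μ.comap (↑)`, `ν.comap (↑)`. -/
def ProperlyVirtuallyContinuous {X Y : Type*} [MeasurableSpace X] [MeasurableSpace Y]
    (μ : Measure X) (ν : Measure Y) (f : X × Y → ℝ) : Prop :=
  AEMeasurable f (μ.prod ν) ∧
    ∀ ε : ℝ, 0 < ε → ∃ (X' : Set X) (Y' : Set Y),
      MeasurableSet X' ∧ MeasurableSet Y' ∧ 1 - ε ≤ μ.real X' ∧ 1 - ε ≤ ν.real Y' ∧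
      ∃ (ρX : PseudoMetricSpace X') (ρY : PseudoMetricSpace Y'),
        IsAdmissible (μ.comap ((↑) : X' → X)) ρX ∧ IsAdmissible (ν.comap ((↑) : Y' → Y)) ρY ∧
        Continuous (fun p : X' × Y' => f (p.1, p.2))

/-- A function is virtually continuous if it coincides almost everywhere with a properly virtually
continuous function. -/
def VirtuallyContinuous {X Y : Type*} [MeasurableSpace X] [MeasurableSpace Y]
    (μ : Measure X) (ν : Measure Y) (f : X × Y → ℝ) : Prop :=
  ∃ g : X × Y → ℝ, ProperlyVirtuallyContinuous μ ν g ∧ f =ᵐ[μ.prod ν] g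

/-- The (possibly infinite) regulator norm `SR¹`: the infimum of `∫ a dμ + ∫ b dν` over
nonnegative `a`, `b` with `|f(x, y)| ≤ a(x) + b(y)` almost everywhere. -/
noncomputable def srNorm {X Y : Type*} [MeasurableSpace X] [MeasurableSpace Y]
    (μ : Measure X) (ν : Measure Y) (f : X × Y → ℝ) : ℝ≥0∞ :=
  ⨅ (a : X → ℝ≥0) (b : Y → ℝ≥0) (_ : Measurable a) (_ : Measurable b)
    (_ : ∀ᵐ z ∂(μ.prod ν), |f z| ≤ a z.1 + b z.2),
    ∫⁻ x, a x ∂μ + ∫⁻ y, b y ∂ν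

/-- The norm of `QB^∞`: the maximum of the `L^∞` norms of the densities of the marginals of the
total variation of `η`. -/
noncomputable def qbNorm {X Y : Type*} [MeasurableSpace X] [MeasurableSpace Y]
    (μ : Measure X) (ν : Measure Y) (η : SignedMeasure (X × Y)) : ℝ≥0∞ :=
  max (essSup ((η.variation.map Prod.fst).rnDeriv μ) μ)
    (essSup ((η.variation.map Prod.snd).rnDeriv ν) ν)

/-- A signed measure is quasi-bistochastic if the marginals of its total variation are absolutely
continuous. -/
def IsQuasiBistochastic {X Y : Type*} [MeasurableSpace X] [MeasurableSpace Y]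
    (μ : Measure X) (ν : Measure Y) (η : SignedMeasure (X × Y)) : Prop :=
  η.variation.map Prod.fst ≪ μ ∧ η.variation.map Prod.snd ≪ ν

/-! ### Virtually continuous functions form a vector space -/

section VC

variable {X Y : Type*} [MeasurableSpace X] [MeasurableSpace Y]

theorem IsAdmissible.inf {μ : Measure X} [IsFiniteMeasure μ] {A B : Set X}
    (hA : MeasurableSet A) (hB : MeasurableSet B)
    {ρ : PseudoMetricSpace A} {σ : PseudoMetricSpace B}
    (hρ : IsAdmissible (μ.comap ((↑) : A → X)) ρ)
    (hσ : IsAdmissible (μ.comap ((↑) : B → X)) σ) :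
    ∃ τ : PseudoMetricSpace ↥(A ∩ B), IsAdmissible (μ.comap ((↑) : ↥(A ∩ B) → X)) τ ∧
      Continuous (Set.inclusion (Set.inter_subset_left : A ∩ B ⊆ A)) ∧
      Continuous (Set.inclusion (Set.inter_subset_right : A ∩ B ⊆ B)) := by
  let i : ↥(A ∩ B) → A := Set.inclusion Set.inter_subset_left
  let j : ↥(A ∩ B) → B := Set.inclusion Set.inter_subset_right
  let φ : ↥(A ∩ B) → A × B := fun x => (i x, j x)
  let τ : PseudoMetricSpace ↥(A ∩ B) := PseudoMetricSpace.induced φ inferInstance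
  have hind : Topology.IsInducing φ := ⟨rfl⟩
  have hAB := hA.inter hB
  have key : ∀ (C : Set X) (hC : MeasurableSet C) (h : A ∩ B ⊆ C),
      Measure.QuasiMeasurePreserving (Set.inclusion h)
        (μ.comap ((↑) : ↥(A ∩ B) → X)) (μ.comap ((↑) : C → X)) := by
    intro C hC h
    refine ⟨measurable_inclusion h, Measure.AbsolutelyContinuous.mk fun s hs h0 => ?_⟩
    rw [Measure.map_apply (measurable_inclusion h) hs, comap_subtype_coe_apply hAB]
    rw [comap_subtype_coe_apply hC] at h0
    refine measure_mono_null ?_ h0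
    rintro _ ⟨x, hx, rfl⟩
    exact ⟨_, hx, rfl⟩
  have hi := key A hA Set.inter_subset_left
  have hj := key B hB Set.inter_subset_right
  refine ⟨τ, ⟨?_, ?_⟩, ?_, ?_⟩
  · have h1 := hρ.1.comp_quasiMeasurePreserving (QuasiMeasurePreserving.prodMap hi hi)
    have h2 := hσ.1.comp_quasiMeasurePreserving (QuasiMeasurePreserving.prodMap hj hj)
    exact h1.max h2
  · obtain ⟨-, X₀, h0, hs0⟩ := hρ
    obtain ⟨-, X₁, h1, hs1⟩ := hσ
    refine ⟨i ⁻¹' X₀ ∩ j ⁻¹' X₁, ?_, ?_⟩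
    · rw [Set.compl_inter]
      exact measure_union_null (hi.preimage_null h0) (hj.preimage_null h1)
    · have hsep : IsSeparable (X₀ ×ˢ X₁) := hs0.prod hs1
      have h2 : SecondCountableTopology ↥(X₀ ×ˢ X₁) := hsep.secondCountableTopology
      let S : Set ↥(A ∩ B) := i ⁻¹' X₀ ∩ j ⁻¹' X₁
      let ψ : S → ↥(X₀ ×ˢ X₁) := fun x => ⟨φ x.1, x.2⟩
      have hψ : Topology.IsInducing ψ := by
        have : Topology.IsInducing (((↑) : ↥(X₀ ×ˢ X₁) → A × B) ∘ ψ) :=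
          hind.comp Topology.IsInducing.subtypeVal
        exact Topology.IsInducing.of_comp_iff Topology.IsInducing.subtypeVal |>.1 this
      have : SecondCountableTopology S := hψ.secondCountableTopology
      exact IsSeparable.of_subtype S
  · exact continuous_fst.comp hind.continuous
  · exact continuous_snd.comp hind.continuous

theorem real_inter_ge {μ : Measure X} [IsProbabilityMeasure μ] {A B : Set X} {ε : ℝ}
    (hB : MeasurableSet B)
    (h1 : 1 - ε / 2 ≤ μ.real A) (h2 : 1 - ε / 2 ≤ μ.real B) : 1 - ε ≤ μ.real (A ∩ B) := by
  have h3 := measureReal_union_add_inter (μ := μ) (s := A) hB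
  have h4 : μ.real (A ∪ B) ≤ 1 := measureReal_le_one
  linarith

variable {μ : Measure X} {ν : Measure Y}

theorem ProperlyVirtuallyContinuous.add [IsProbabilityMeasure μ] [IsProbabilityMeasure ν]
    {f g : X × Y → ℝ} (hf : ProperlyVirtuallyContinuous μ ν f)
    (hg : ProperlyVirtuallyContinuous μ ν g) : ProperlyVirtuallyContinuous μ ν (f + g) := by
  refine ⟨hf.1.add hg.1, fun ε hε => ?_⟩
  obtain ⟨A, B, hA, hB, hA', hB', ρA, ρB, aA, aB, hc⟩ := hf.2 (ε / 2) (by positivity)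
  obtain ⟨C, D, hC, hD, hC', hD', ρC, ρD, aC, aD, hd⟩ := hg.2 (ε / 2) (by positivity)
  obtain ⟨τ, hτ, c1, c2⟩ := IsAdmissible.inf hA hC aA aC
  obtain ⟨σ, hσ, c3, c4⟩ := IsAdmissible.inf hB hD aB aD
  refine ⟨A ∩ C, B ∩ D, hA.inter hC, hB.inter hD, real_inter_ge hC hA' hC',
    real_inter_ge hD hB' hD', τ, σ, hτ, hσ, ?_⟩
  exact (hc.comp (c1.prodMap c3)).add (hd.comp (c2.prodMap c4))

theorem ProperlyVirtuallyContinuous.const_smul {f : X × Y → ℝ} (c : ℝ)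
    (hf : ProperlyVirtuallyContinuous μ ν f) : ProperlyVirtuallyContinuous μ ν (c • f) := by
  refine ⟨hf.1.const_smul c, fun ε hε => ?_⟩
  obtain ⟨A, B, hA, hB, hA', hB', ρA, ρB, aA, aB, hc⟩ := hf.2 ε hε
  exact ⟨A, B, hA, hB, hA', hB', ρA, ρB, aA, aB, hc.const_smul c⟩

theorem exists_isAdmissible {Z : Type*} [MeasurableSpace Z] (m : Measure Z) :
    ∃ ρ : PseudoMetricSpace Z, IsAdmissible m ρ := by
  let ρ : PseudoMetricSpace Z := PseudoMetricSpace.induced (fun _ => (0 : ℝ)) inferInstance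
  refine ⟨ρ, ?_, Set.univ, by simp, ?_⟩
  · have : (fun p : Z × Z => ρ.dist p.1 p.2) = fun _ => 0 := by
      funext p; exact dist_self (0 : ℝ)
    rw [this]; exact aemeasurable_const
  · have hind : Topology.IsInducing (fun _ : Z => (0 : ℝ)) := ⟨rfl⟩
    have : SecondCountableTopology Z := hind.secondCountableTopology
    exact IsSeparable.of_separableSpace _

theorem ProperlyVirtuallyContinuous.zero [IsProbabilityMeasure μ] [IsProbabilityMeasure ν] :
    ProperlyVirtuallyContinuous μ ν (0 : X × Y → ℝ) := by
  refine ⟨aemeasurable_const, fun ε hε => ?_⟩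
  obtain ⟨ρ, hρ⟩ := exists_isAdmissible (μ.comap ((↑) : ↥(Set.univ : Set X) → X))
  obtain ⟨σ, hσ⟩ := exists_isAdmissible (ν.comap ((↑) : ↥(Set.univ : Set Y) → Y))
  exact ⟨Set.univ, Set.univ, .univ, .univ, by simp [hε.le], by simp [hε.le], ρ, σ, hρ, hσ,
    continuous_const⟩

/-! ### The regulator norm -/

theorem srNorm_congr {f g : X × Y → ℝ} (h : f =ᵐ[μ.prod ν] g) :
    srNorm μ ν f = srNorm μ ν g := by
  have : ∀ (a : X → ℝ≥0) (b : Y → ℝ≥0),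
      (∀ᵐ z ∂(μ.prod ν), |f z| ≤ a z.1 + b z.2) ↔
        ∀ᵐ z ∂(μ.prod ν), |g z| ≤ a z.1 + b z.2 := fun a b =>
    Filter.eventually_congr (h.mono fun z hz => by rw [hz])
  simp only [srNorm, this]

theorem srNorm_le {f : X × Y → ℝ} {a : X → ℝ≥0} {b : Y → ℝ≥0} (ha : Measurable a)
    (hb : Measurable b) (h : ∀ᵐ z ∂(μ.prod ν), |f z| ≤ a z.1 + b z.2) :
    srNorm μ ν f ≤ ∫⁻ x, a x ∂μ + ∫⁻ y, b y ∂ν :=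
  iInf_le_of_le a <| iInf_le_of_le b <| iInf_le_of_le ha <| iInf_le_of_le hb <| iInf_le _ h

theorem srNorm_zero : srNorm μ ν (0 : X × Y → ℝ) = 0 := by
  refine le_antisymm ((srNorm_le (a := 0) (b := 0) measurable_const measurable_const ?_).trans ?_)
    zero_le
  · simp
  · simp

theorem exists_of_srNorm_lt {f : X × Y → ℝ} {c : ℝ≥0∞} (h : srNorm μ ν f < c) :
    ∃ (a : X → ℝ≥0) (b : Y → ℝ≥0), Measurable a ∧ Measurable b ∧
      (∀ᵐ z ∂(μ.prod ν), |f z| ≤ a z.1 + b z.2) ∧ ∫⁻ x, a x ∂μ + ∫⁻ y, b y ∂ν < c := by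
  simp only [srNorm, iInf_lt_iff] at h
  obtain ⟨a, b, ha, hb, hab, hlt⟩ := h
  exact ⟨a, b, ha, hb, hab, hlt⟩

theorem srNorm_add_le (f g : X × Y → ℝ) :
    srNorm μ ν (f + g) ≤ srNorm μ ν f + srNorm μ ν g := by
  refine ENNReal.le_of_forall_pos_le_add fun ε hε hfin => ?_
  have hε2 : (ε / 2 : ℝ≥0∞) ≠ 0 := by simp [hε.ne']
  obtain ⟨hf, hg⟩ := ENNReal.add_lt_top.1 hfin
  obtain ⟨a, b, ha, hb, hab, hlt⟩ := exists_of_srNorm_lt (ENNReal.lt_add_right hf.ne hε2)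
  obtain ⟨a', b', ha', hb', hab', hlt'⟩ := exists_of_srNorm_lt (ENNReal.lt_add_right hg.ne hε2)
  have h1 : srNorm μ ν (f + g) ≤ ∫⁻ x, (a + a') x ∂μ + ∫⁻ y, (b + b') y ∂ν := by
    refine srNorm_le (ha.add ha') (hb.add hb') ?_
    filter_upwards [hab, hab'] with z hz hz'
    have := abs_add_le (f z) (g z)
    simp only [Pi.add_apply, NNReal.coe_add]
    linarith
  refine h1.trans ?_
  simp only [Pi.add_apply, ENNReal.coe_add]
  rw [lintegral_add_left ha.coe_nnreal_ennreal, lintegral_add_left hb.coe_nnreal_ennreal]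
  calc _ = (∫⁻ x, a x ∂μ + ∫⁻ y, b y ∂ν) + (∫⁻ x, a' x ∂μ + ∫⁻ y, b' y ∂ν) := by
        rw [add_add_add_comm]
    _ ≤ (srNorm μ ν f + ε / 2) + (srNorm μ ν g + ε / 2) := add_le_add hlt.le hlt'.le
    _ = _ := by rw [add_add_add_comm, ENNReal.add_halves]

theorem srNorm_smul_le (c : ℝ) (f : X × Y → ℝ) :
    srNorm μ ν (c • f) ≤ ‖c‖ₑ * srNorm μ ν f := by
  rcases eq_or_ne c 0 with rfl | hc
  · simp [srNorm_zero]
  have hc0 : ‖c‖ₑ ≠ 0 := by simpa using hc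
  rw [mul_comm, ← ENNReal.div_le_iff hc0 enorm_ne_top]
  refine le_of_forall_gt fun d hd => ?_
  obtain ⟨a, b, ha, hb, hab, hlt⟩ := exists_of_srNorm_lt hd
  refine lt_of_le_of_lt ?_ hlt
  rw [ENNReal.div_le_iff hc0 enorm_ne_top]
  have h1 : srNorm μ ν (c • f) ≤ ∫⁻ x, (‖c‖₊ • a) x ∂μ + ∫⁻ y, (‖c‖₊ • b) y ∂ν := by
    refine srNorm_le (ha.const_smul _) (hb.const_smul _) ?_
    filter_upwards [hab] with z hz
    simp only [Pi.smul_apply, smul_eq_mul, abs_mul, NNReal.coe_mul, coe_nnnorm, Real.norm_eq_abs]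
    rw [← mul_add]
    exact mul_le_mul_of_nonneg_left hz (abs_nonneg c)
  refine h1.trans (le_of_eq ?_)
  simp only [Pi.smul_apply, smul_eq_mul, ENNReal.coe_mul]
  rw [lintegral_const_mul _ ha.coe_nnreal_ennreal, lintegral_const_mul _ hb.coe_nnreal_ennreal,
    ← mul_add, mul_comm]
  rfl

theorem srNorm_smul (c : ℝ) (f : X × Y → ℝ) :
    srNorm μ ν (c • f) = ‖c‖ₑ * srNorm μ ν f := by
  refine le_antisymm (srNorm_smul_le c f) ?_
  rcases eq_or_ne c 0 with rfl | hc
  · simp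
  have h := srNorm_smul_le (μ := μ) (ν := ν) c⁻¹ (c • f)
  rw [inv_smul_smul₀ hc] at h
  calc ‖c‖ₑ * srNorm μ ν f ≤ ‖c‖ₑ * (‖c⁻¹‖ₑ * srNorm μ ν (c • f)) := by gcongr
    _ = srNorm μ ν (c • f) := by
      rw [← mul_assoc, ← enorm_mul, mul_inv_cancel₀ hc]; simp

theorem lintegral_le_srNorm [IsProbabilityMeasure μ] [IsProbabilityMeasure ν]
    (f : X × Y → ℝ) : ∫⁻ z, ‖f z‖ₑ ∂(μ.prod ν) ≤ srNorm μ ν f := by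
  refine le_of_forall_gt fun d hd => ?_
  obtain ⟨a, b, ha, hb, hab, hlt⟩ := exists_of_srNorm_lt hd
  refine lt_of_le_of_lt ?_ hlt
  calc ∫⁻ z, ‖f z‖ₑ ∂(μ.prod ν) ≤ ∫⁻ z, ((a z.1 : ℝ≥0∞) + b z.2) ∂(μ.prod ν) := by
        refine lintegral_mono_ae ?_
        filter_upwards [hab] with z hz
        rw [← ENNReal.coe_add, enorm_eq_nnnorm, ENNReal.coe_le_coe, ← NNReal.coe_le_coe]
        simpa using hz
    _ = ∫⁻ x, a x ∂μ + ∫⁻ y, b y ∂ν := by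
        rw [lintegral_add_left (by fun_prop)]
        congr 1
        · exact measurePreserving_fst.lintegral_comp ha.coe_nnreal_ennreal
        · exact measurePreserving_snd.lintegral_comp hb.coe_nnreal_ennreal

end VC

/-! ### The space `VC¹` -/

section VCSpace

variable {X Y : Type*} [MeasurableSpace X] [MeasurableSpace Y]

/-- `VC¹`: the space of (classes modulo almost everywhere equality of) virtually continuous
functions with finite regulator norm. -/
def VC1 (μ : Measure X) (ν : Measure Y) [IsProbabilityMeasure μ] [IsProbabilityMeasure ν] :
    Submodule ℝ (X × Y →ₘ[μ.prod ν] ℝ) where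
  carrier := {f | VirtuallyContinuous μ ν f ∧ srNorm μ ν f < ∞}
  add_mem' := by
    rintro f g ⟨⟨f', hf', hff'⟩, hf⟩ ⟨⟨g', hg', hgg'⟩, hg⟩
    refine ⟨⟨f' + g', hf'.add hg', (AEEqFun.coeFn_add f g).trans (hff'.add hgg')⟩, ?_⟩
    rw [srNorm_congr (AEEqFun.coeFn_add f g)]
    exact (srNorm_add_le _ _).trans_lt (ENNReal.add_lt_top.2 ⟨hf, hg⟩)
  zero_mem' := by
    refine ⟨⟨0, .zero, AEEqFun.coeFn_zero⟩, ?_⟩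
    rw [srNorm_congr AEEqFun.coeFn_zero, srNorm_zero]
    exact ENNReal.zero_lt_top
  smul_mem' := by
    rintro c f ⟨⟨f', hf', hff'⟩, hf⟩
    refine ⟨⟨c • f', hf'.const_smul c, (AEEqFun.coeFn_smul c f).trans (hff'.const_smul c)⟩, ?_⟩
    rw [srNorm_congr (AEEqFun.coeFn_smul c f), srNorm_smul]
    exact ENNReal.mul_lt_top enorm_lt_top hf

variable {μ : Measure X} {ν : Measure Y} [IsProbabilityMeasure μ] [IsProbabilityMeasure ν]

noncomputable instance VC1.instNorm : Norm (VC1 μ ν) :=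
  ⟨fun f => (srNorm μ ν (f : X × Y →ₘ[μ.prod ν] ℝ)).toReal⟩

theorem VC1.norm_def (f : VC1 μ ν) :
    ‖f‖ = (srNorm μ ν (f : X × Y →ₘ[μ.prod ν] ℝ)).toReal := rfl

theorem VC1.core : NormedSpace.Core ℝ (VC1 μ ν) where
  norm_nonneg _ := ENNReal.toReal_nonneg
  norm_smul c f := by
    rw [VC1.norm_def, VC1.norm_def, Submodule.coe_smul, srNorm_congr (AEEqFun.coeFn_smul c f.1),
      srNorm_smul, ENNReal.toReal_mul, toReal_enorm]
  norm_triangle f g := by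
    rw [VC1.norm_def, VC1.norm_def, VC1.norm_def, Submodule.coe_add,
      srNorm_congr (AEEqFun.coeFn_add f.1 g.1), ← ENNReal.toReal_add f.2.2.ne g.2.2.ne]
    exact ENNReal.toReal_mono (ENNReal.add_ne_top.2 ⟨f.2.2.ne, g.2.2.ne⟩) (srNorm_add_le _ _)
  norm_eq_zero_iff f := by
    rw [VC1.norm_def, ENNReal.toReal_eq_zero_iff, or_iff_left f.2.2.ne]
    constructor
    · intro h
      have h1 : ∫⁻ z, ‖f.1 z‖ₑ ∂(μ.prod ν) = 0 :=
        le_antisymm ((lintegral_le_srNorm _).trans h.le) zero_le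
      rw [lintegral_eq_zero_iff' f.1.aemeasurable.enorm] at h1
      refine Subtype.ext (AEEqFun.ext ?_)
      refine Filter.EventuallyEq.trans ?_ AEEqFun.coeFn_zero.symm
      filter_upwards [h1] with z hz
      simpa using hz
    · rintro rfl
      rw [Submodule.coe_zero, srNorm_congr AEEqFun.coeFn_zero, srNorm_zero]

noncomputable instance VC1.instNormedAddCommGroup : NormedAddCommGroup (VC1 μ ν) :=
  NormedAddCommGroup.ofCore VC1.core

noncomputable instance VC1.instNormedSpace : NormedSpace ℝ (VC1 μ ν) :=
  NormedSpace.ofCore VC1.core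

end VCSpace

/-! ### The space `QB^∞` -/

section QB

theorem marginal_bound_iff {Z : Type*} [MeasurableSpace Z] {m κ : Measure Z} [IsFiniteMeasure m]
    [IsFiniteMeasure κ] {c : ℝ≥0∞} :
    (κ ≪ m ∧ essSup (κ.rnDeriv m) m ≤ c) ↔ κ ≤ c • m := by
  constructor
  · rintro ⟨h1, h2⟩
    rw [← Measure.withDensity_rnDeriv_eq κ m h1, ← withDensity_const]
    exact withDensity_mono ((ENNReal.ae_le_essSup _).mono fun x hx => hx.trans h2)
  · intro h
    refine ⟨Measure.absolutelyContinuous_of_le_smul h, ?_⟩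
    rcases eq_or_ne c ∞ with rfl | hc
    · exact le_top
    refine essSup_le_of_ae_le _ ?_
    refine ae_le_of_forall_setLIntegral_le_of_sigmaFinite (Measure.measurable_rnDeriv _ _)
      fun s hs _ => ?_
    refine (Measure.setLIntegral_rnDeriv_le s).trans ((h s).trans (le_of_eq ?_))
    simp

variable {X Y : Type*} [MeasurableSpace X] [MeasurableSpace Y]

instance SignedMeasure.isFiniteMeasure_variation {Z : Type*} [MeasurableSpace Z]
    (η : SignedMeasure Z) : IsFiniteMeasure η.variation := by
  rw [← SignedMeasure.totalVariation_eq_variation]; infer_instance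

theorem qb_iff {μ : Measure X} {ν : Measure Y} [IsFiniteMeasure μ] [IsFiniteMeasure ν]
    {η : SignedMeasure (X × Y)} {c : ℝ≥0∞} :
    (IsQuasiBistochastic μ ν η ∧ qbNorm μ ν η ≤ c) ↔
      (η.variation.map Prod.fst ≤ c • μ ∧ η.variation.map Prod.snd ≤ c • ν) := by
  rw [← marginal_bound_iff, ← marginal_bound_iff, qbNorm, max_le_iff, IsQuasiBistochastic]
  tauto

theorem qb_add {μ : Measure X} {ν : Measure Y} [IsFiniteMeasure μ] [IsFiniteMeasure ν]
    {η ξ : SignedMeasure (X × Y)} (hη : IsQuasiBistochastic μ ν η)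
    (hξ : IsQuasiBistochastic μ ν ξ) :
    IsQuasiBistochastic μ ν (η + ξ) ∧ qbNorm μ ν (η + ξ) ≤ qbNorm μ ν η + qbNorm μ ν ξ := by
  obtain ⟨h1, h2⟩ := qb_iff.1 ⟨hη, le_rfl⟩
  obtain ⟨h3, h4⟩ := qb_iff.1 ⟨hξ, le_rfl⟩
  refine qb_iff.2 ⟨?_, ?_⟩
  · refine (Measure.map_mono VectorMeasure.variation_add_le measurable_fst).trans ?_
    rw [Measure.map_add _ _ measurable_fst, add_smul]
    exact add_le_add h1 h3
  · refine (Measure.map_mono VectorMeasure.variation_add_le measurable_snd).trans ?_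
    rw [Measure.map_add _ _ measurable_snd, add_smul]
    exact add_le_add h2 h4

theorem qb_smul_le {μ : Measure X} {ν : Measure Y} [IsFiniteMeasure μ] [IsFiniteMeasure ν]
    {η : SignedMeasure (X × Y)} (c : ℝ) (hη : IsQuasiBistochastic μ ν η) :
    IsQuasiBistochastic μ ν (c • η) ∧ qbNorm μ ν (c • η) ≤ ‖c‖ₑ * qbNorm μ ν η := by
  obtain ⟨h1, h2⟩ := qb_iff.1 ⟨hη, le_rfl⟩
  have hv : (c • η).variation = ‖c‖ₑ • η.variation := VectorMeasure.variation_smul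
  refine qb_iff.2 ⟨?_, ?_⟩
  · rw [hv, Measure.map_smul, mul_smul]
    gcongr
  · rw [hv, Measure.map_smul, mul_smul]
    gcongr

theorem qb_smul {μ : Measure X} {ν : Measure Y} [IsFiniteMeasure μ] [IsFiniteMeasure ν]
    {η : SignedMeasure (X × Y)} (c : ℝ) (hη : IsQuasiBistochastic μ ν η) :
    qbNorm μ ν (c • η) = ‖c‖ₑ * qbNorm μ ν η := by
  refine le_antisymm (qb_smul_le c hη).2 ?_
  rcases eq_or_ne c 0 with rfl | hc
  · simp
  have h := (qb_smul_le c⁻¹ (qb_smul_le c hη).1).2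
  rw [inv_smul_smul₀ hc] at h
  calc ‖c‖ₑ * qbNorm μ ν η ≤ ‖c‖ₑ * (‖c⁻¹‖ₑ * qbNorm μ ν (c • η)) := by gcongr
    _ = qbNorm μ ν (c • η) := by
      rw [← mul_assoc, ← enorm_mul, mul_inv_cancel₀ hc]; simp

theorem qb_zero {μ : Measure X} {ν : Measure Y} [IsFiniteMeasure μ] [IsFiniteMeasure ν] :
    IsQuasiBistochastic μ ν 0 ∧ qbNorm μ ν 0 ≤ 0 := by
  refine qb_iff.2 ⟨?_, ?_⟩ <;> simp

/-- `QB^∞`: the space of quasi-bistochastic signed measures with finite norm. -/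
def QBInfty (μ : Measure X) (ν : Measure Y) [IsFiniteMeasure μ] [IsFiniteMeasure ν] :
    Submodule ℝ (SignedMeasure (X × Y)) where
  carrier := {η | IsQuasiBistochastic μ ν η ∧ qbNorm μ ν η < ∞}
  add_mem' := by
    rintro η ξ ⟨hη, hη'⟩ ⟨hξ, hξ'⟩
    obtain ⟨h1, h2⟩ := qb_add hη hξ
    exact ⟨h1, h2.trans_lt (ENNReal.add_lt_top.2 ⟨hη', hξ'⟩)⟩
  zero_mem' := ⟨qb_zero.1, qb_zero.2.trans_lt ENNReal.zero_lt_top⟩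
  smul_mem' := by
    rintro c η ⟨hη, hη'⟩
    obtain ⟨h1, h2⟩ := qb_smul_le c hη
    exact ⟨h1, h2.trans_lt (ENNReal.mul_lt_top enorm_lt_top hη')⟩

variable {μ : Measure X} {ν : Measure Y} [IsFiniteMeasure μ] [IsFiniteMeasure ν]

noncomputable instance QBInfty.instNorm : Norm (QBInfty μ ν) :=
  ⟨fun η => (qbNorm μ ν (η : SignedMeasure (X × Y))).toReal⟩

theorem QBInfty.norm_def (η : QBInfty μ ν) :
    ‖η‖ = (qbNorm μ ν (η : SignedMeasure (X × Y))).toReal := rfl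

theorem QBInfty.core : NormedSpace.Core ℝ (QBInfty μ ν) where
  norm_nonneg _ := ENNReal.toReal_nonneg
  norm_smul c η := by
    rw [QBInfty.norm_def, QBInfty.norm_def, Submodule.coe_smul, qb_smul c η.2.1,
      ENNReal.toReal_mul, toReal_enorm]
  norm_triangle η ξ := by
    rw [QBInfty.norm_def, QBInfty.norm_def, QBInfty.norm_def, Submodule.coe_add,
      ← ENNReal.toReal_add η.2.2.ne ξ.2.2.ne]
    exact ENNReal.toReal_mono (ENNReal.add_ne_top.2 ⟨η.2.2.ne, ξ.2.2.ne⟩)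
      (qb_add η.2.1 ξ.2.1).2
  norm_eq_zero_iff η := by
    rw [QBInfty.norm_def, ENNReal.toReal_eq_zero_iff, or_iff_left η.2.2.ne]
    constructor
    · intro h
      have h1 := (qb_iff.1 ⟨η.2.1, h.le⟩).1
      rw [zero_smul] at h1
      have h2 : η.1.variation.map Prod.fst = 0 := le_antisymm h1 (Measure.zero_le _)
      rw [Measure.map_eq_zero_iff measurable_fst.aemeasurable,
        VectorMeasure.variation_eq_zero] at h2
      exact Subtype.ext h2
    · rintro rfl
      exact le_antisymm qb_zero.2 zero_le

noncomputable instance QBInfty.instNormedAddCommGroup : NormedAddCommGroup (QBInfty μ ν) :=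
  NormedAddCommGroup.ofCore QBInfty.core

noncomputable instance QBInfty.instNormedSpace : NormedSpace ℝ (QBInfty μ ν) :=
  NormedSpace.ofCore QBInfty.core

end QB

/-! A measure `η` in `QBInfty` may be singular to `μ.prod ν` (for instance live on a diagonal), so
pairing it with an almost-everywhere class needs a trace theorem. After refining the Polish
topologies without changing Borel sets, a properly virtually continuous function is continuous on `K
×ˢ L`, with `K` and `L` compact of almost full measure
(`ProperlyVirtuallyContinuous.exists_compact`). A measure `κ` with marginals at most `c • μ` and `c
• ν` gives the rest mass at most `c * (μ Kᶜ + ν Lᶜ)`. On `K ×ˢ L`, continuity spreads a failure of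
`f ≤ a + b` at one point over a relative rectangle; a product-null rectangle has a null side and is
therefore `κ`-null. Hence such bounds transfer to `κ` (`ProperlyVirtuallyContinuous.ae_le_add`),
which makes the pairing well defined with norm at most `‖η‖`.

For the reverse inequality, indicators of sets in the algebra of rectangles belong to `VC1`. A
function with values in `{-1, 0, 1}` supported over `A` has norm at most `μ A`, or `ν A` on the
other side. Approximating a Hahn decomposition of `η` within the algebra bounds both marginals of
the variation.

For surjectivity, a functional restricted to these indicators is a finitely additive set function.
The positive variations of `Λ` and `-Λ` have marginals at most `‖Λ‖` times `μ` and `ν`, so inner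
regularity of `μ` and `ν` makes them countably additive (`exists_measure_eq_addContent`). Their sum
dominates the signed content, which then extends to a signed measure; density of step functions
(`dense_span_rectInd`) shows that this measure represents `Λ`. -/

/-! ### Compact exhaustion for properly virtually continuous functions -/

section Structure

open Set Topology

/-- On a conull measurable set, the topology of an admissible semimetric is generated by countably
many measurable sets. -/
theorem IsAdmissible.exists_countable_base {Z : Type*} [MeasurableSpace Z] {m : Measure Z}
    [SFinite m] {ρ : PseudoMetricSpace Z} (h : IsAdmissible m ρ) :
    ∃ (Z₂ : Set Z) (𝒜 : Set (Set Z)), MeasurableSet Z₂ ∧ m Z₂ᶜ = 0 ∧ 𝒜.Countable ∧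
      (∀ A ∈ 𝒜, MeasurableSet A) ∧
      ∀ U : Set Z, IsOpen U → ∀ x ∈ U ∩ Z₂, ∃ A ∈ 𝒜, x ∈ A ∧ A ∩ Z₂ ⊆ U := by
  obtain ⟨hmeas, X₀, h0, hsep⟩ := h
  have hG : ∀ᵐ x ∂m, AEMeasurable (fun y => dist x y) m :=
    hmeas.aestronglyMeasurable.prodMk_left.mono fun x hx => hx.aemeasurable
  set G : Set Z := {x | AEMeasurable (fun y => dist x y) m}
  -- The centres are taken inside `G` because measurability for the completed product only controls
  -- almost every section of the semimetric.
  obtain ⟨D, hDs, hDc, hD⟩ :=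
    (hsep.mono (inter_subset_left : X₀ ∩ G ⊆ X₀)).exists_countable_dense_subset
  have hDG : ∀ d : D, AEMeasurable (fun y => dist (d : Z) y) m := fun d => (hDs d.2).2
  choose g hg hgd using hDG
  have : Countable D := hDc
  have hX₀ : ∀ᵐ x ∂m, x ∈ X₀ := h0
  have hall : ∀ᵐ x ∂m, x ∈ X₀ ∧ x ∈ G ∧ ∀ d : D, dist (d : Z) x = g d x := by
    filter_upwards [hX₀, hG, ae_all_iff.2 hgd] with x h1 h2 h3 using ⟨h1, h2, h3⟩
  obtain ⟨N, hN, hNm, hN0⟩ := exists_measurable_superset_of_null (ae_iff.1 hall)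
  have hgood : ∀ x ∈ Nᶜ, x ∈ X₀ ∧ x ∈ G ∧ ∀ d : D, dist (d : Z) x = g d x := by
    intro x hx
    by_contra hcon
    exact hx (hN hcon)
  -- Measurable versions of the rational balls about points of `D`; off `N` they coincide with the
  -- balls themselves.
  refine ⟨Nᶜ, range fun p : D × ℚ => {x | g p.1 x < p.2}, hNm.compl, by simpa using hN0,
    countable_range _, ?_, ?_⟩
  · rintro _ ⟨p, rfl⟩
    exact measurableSet_lt (hg p.1) measurable_const
  · rintro U hU x ⟨hxU, hxN⟩
    obtain ⟨ε, hε, hball⟩ := Metric.isOpen_iff.1 hU x hxU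
    obtain ⟨hx0, hxG, hxg⟩ := hgood x hxN
    obtain ⟨d, hd, hxd⟩ := Metric.mem_closure_iff.1 (hD ⟨hx0, hxG⟩) (ε / 2) (by positivity)
    obtain ⟨q, hq1, hq2⟩ := exists_rat_btwn hxd
    refine ⟨_, ⟨(⟨d, hd⟩, q), rfl⟩, ?_, ?_⟩
    · change g ⟨d, hd⟩ x < q
      rw [← hxg, dist_comm]
      exact hq1
    · rintro y ⟨hy : g ⟨d, hd⟩ y < q, hyN⟩
      rw [← (hgood y hyN).2.2 ⟨d, hd⟩] at hy
      refine hball ?_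
      have := dist_triangle y d x
      rw [dist_comm y d, dist_comm d x] at this
      rw [Metric.mem_ball]
      change dist d y < q at hy
      linarith

/-- Countably many measurable sets in a standard Borel space are open for some compatible Polish
topology. -/
theorem exists_polish_forall_isOpen {X : Type*} [MeasurableSpace X] [StandardBorelSpace X]
    {𝒜 : Set (Set X)} (hc : 𝒜.Countable) (hm : ∀ A ∈ 𝒜, MeasurableSet A) :
    ∃ _ : TopologicalSpace X, PolishSpace X ∧ BorelSpace X ∧ ∀ A ∈ 𝒜, IsOpen A := by
  let := upgradeStandardBorel X
  have hcl : ∀ A : 𝒜, PolishSpace.IsClopenable (A : Set X) := fun A =>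
    (hm A A.2).isClopenable
  choose t tle tp _ topen using hcl
  have : Countable 𝒜 := hc
  obtain ⟨t', ht', hle, hp⟩ := PolishSpace.exists_polishSpace_forall_le t tle tp
  refine ⟨t', hp, ?_, fun A hA => ht' ⟨A, hA⟩ _ (topen ⟨A, hA⟩)⟩
  refine @BorelSpace.mk _ t' _ ?_
  -- Two comparable Polish topologies have the same Borel sets.
  rw [eq_borel_upgradeStandardBorel X, borel_eq_borel_of_le hp _ hle]
  infer_instance

/-- An admissible semimetric on a measurable subset of a standard Borel space is continuous, on
compact sets of almost full measure, for some compatible Polish topology. -/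
theorem IsAdmissible.exists_polish_compact {X : Type*} [MeasurableSpace X] [StandardBorelSpace X]
    {μ : Measure X} [IsFiniteMeasure μ] {X' : Set X} (hX' : MeasurableSet X')
    {ρ : PseudoMetricSpace X'} (h : IsAdmissible (μ.comap ((↑) : X' → X)) ρ) {ε : ℝ≥0∞}
    (hε : ε ≠ 0) :
    ∃ (_ : TopologicalSpace X) (K : Set X), PolishSpace X ∧ BorelSpace X ∧ IsCompact K ∧
      K ⊆ X' ∧ μ (X' \ K) ≤ ε ∧
      ∀ U : Set X', IsOpen[ρ.toUniformSpace.toTopologicalSpace] U → ∀ x : X', x ∈ U → (x : X) ∈ K →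
        ∃ V : Set X, IsOpen V ∧ (x : X) ∈ V ∧ ∀ y : X', (y : X) ∈ V ∩ K → y ∈ U := by
  have hemb := MeasurableEmbedding.subtype_coe hX'
  have : IsFiniteMeasure (μ.comap ((↑) : X' → X)) := by
    refine ⟨?_⟩
    rw [comap_subtype_coe_apply hX']
    exact measure_lt_top _ _
  obtain ⟨Z, 𝒜, hZ, hZ0, hc, hm, hb⟩ := h.exists_countable_base
  obtain ⟨t, hp, hB, ho⟩ := exists_polish_forall_isOpen (hc.image fun A => ((↑) : X' → X) '' A)
    (by rintro _ ⟨A, hA, rfl⟩; exact hemb.measurableSet_image.2 (hm A hA))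
  have hZX : MeasurableSet (((↑) : X' → X) '' Z) := hemb.measurableSet_image.2 hZ
  obtain ⟨K, hKZ, hK, hlt⟩ := hZX.exists_isCompact_sdiff_lt (μ := μ) (measure_ne_top _ _) hε
  refine ⟨t, K, hp, hB, hK, hKZ.trans (by simp), ?_, ?_⟩
  · calc μ (X' \ K) ≤ μ ((((↑) : X' → X) '' Z) \ K ∪ ((↑) : X' → X) '' Zᶜ) := by
          refine measure_mono ?_
          rintro x ⟨hx, hxK⟩
          by_cases hxZ : (⟨x, hx⟩ : X') ∈ Z
          · exact Or.inl ⟨⟨_, hxZ, rfl⟩, hxK⟩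
          · exact Or.inr ⟨_, hxZ, rfl⟩
      _ ≤ μ ((((↑) : X' → X) '' Z) \ K) + μ (((↑) : X' → X) '' Zᶜ) := measure_union_le _ _
      _ ≤ ε := by
          rw [← comap_subtype_coe_apply hX' μ, hZ0, add_zero]
          exact hlt.le
  · intro U hU x hxU hxK
    have hsub : ∀ y : X', (y : X) ∈ K → y ∈ Z := by
      intro y hy
      obtain ⟨z, hz, hzy⟩ := hKZ hy
      rwa [← Subtype.ext hzy]
    obtain ⟨A, hA, hxA, hAU⟩ := hb U hU x ⟨hxU, hsub x hxK⟩
    refine ⟨_, ho _ ⟨A, hA, rfl⟩, ⟨x, hxA, rfl⟩, ?_⟩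
    rintro y ⟨⟨z, hz, hzy⟩, hyK⟩
    have : z = y := Subtype.ext hzy
    subst this
    exact hAU ⟨hz, hsub z hyK⟩

variable {X Y : Type*} [MeasurableSpace X] [StandardBorelSpace X]
    [MeasurableSpace Y] [StandardBorelSpace Y] {μ : Measure X} {ν : Measure Y}
    [IsProbabilityMeasure μ] [IsProbabilityMeasure ν]

theorem measure_compl_le_of_one_sub_le {Z : Type*} [MeasurableSpace Z] {m : Measure Z}
    [IsProbabilityMeasure m] {A K : Set Z} (hA : MeasurableSet A) {ε : ℝ} (hε : 0 ≤ ε)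
    (h : 1 - ε ≤ m.real A) (hK : m (A \ K) ≤ ENNReal.ofReal ε) :
    m Kᶜ ≤ ENNReal.ofReal (2 * ε) := by
  have h1 : m Aᶜ ≤ ENNReal.ofReal ε := by
    rw [← ofReal_measureReal, probReal_compl_eq_one_sub hA]
    exact ENNReal.ofReal_le_ofReal (by linarith)
  calc m Kᶜ ≤ m (Aᶜ ∪ A \ K) := measure_mono fun x hx => by
        by_cases hxA : x ∈ A
        · exact Or.inr ⟨hxA, hx⟩
        · exact Or.inl hxA
    _ ≤ m Aᶜ + m (A \ K) := measure_union_le _ _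
    _ ≤ ENNReal.ofReal ε + ENNReal.ofReal ε := add_le_add h1 hK
    _ = _ := by rw [← ENNReal.ofReal_add hε hε]; congr 1; ring

/-- A properly virtually continuous function is continuous, for suitable compatible Polish
topologies, on products of compact sets of almost full measure. -/
theorem ProperlyVirtuallyContinuous.exists_compact {f : X × Y → ℝ}
    (hf : ProperlyVirtuallyContinuous μ ν f) {ε : ℝ} (hε : 0 < ε) :
    ∃ (_ : TopologicalSpace X) (_ : TopologicalSpace Y) (K : Set X) (L : Set Y),
      PolishSpace X ∧ BorelSpace X ∧ PolishSpace Y ∧ BorelSpace Y ∧ IsCompact K ∧ IsCompact L ∧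
      μ Kᶜ ≤ ENNReal.ofReal ε ∧ ν Lᶜ ≤ ENNReal.ofReal ε ∧ ContinuousOn f (K ×ˢ L) := by
  -- One half is spent on the complement of `A` (or `B`), the other on passing to a compact subset.
  have hε2 : 0 < ε / 2 := by positivity
  obtain ⟨A, B, hA, hB, hA', hB', ρA, ρB, aA, aB, hc⟩ := hf.2 (ε / 2) hε2
  have h0 : ENNReal.ofReal (ε / 2) ≠ 0 := by simpa using hε
  -- Continuity is unfolded into open rectangles while the semimetric topologies are the only ones
  -- present; the Polish topologies chosen next would induce others on `A` and `B`.
  have key : ∀ (x : A) (y : B), ∀ s ∈ 𝓝 (f (x, y)), ∃ (U : Set A) (V : Set B),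
      IsOpen[ρA.toUniformSpace.toTopologicalSpace] U ∧ x ∈ U ∧
      IsOpen[ρB.toUniformSpace.toTopologicalSpace] V ∧ y ∈ V ∧
      ∀ p : A × B, p ∈ U ×ˢ V → f (p.1, p.2) ∈ s := by
    intro x y s hs
    obtain ⟨U, V, hU, hxU, hV, hyV, hUV⟩ := mem_nhds_prod_iff'.1
      ((hc.continuousAt (x := (x, y))).preimage_mem_nhds hs)
    exact ⟨U, V, hU, hxU, hV, hyV, fun p hp => hUV hp⟩
  obtain ⟨tX, K, pX, bX, hK, hKA, hμK, hKo⟩ := aA.exists_polish_compact hA h0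
  obtain ⟨tY, L, pY, bY, hL, hLB, hνL, hLo⟩ := aB.exists_polish_compact hB h0
  refine ⟨tX, tY, K, L, pX, bX, pY, bY, hK, hL, ?_, ?_, ?_⟩
  · have := measure_compl_le_of_one_sub_le hA hε2.le hA' hμK
    rwa [mul_div_cancel₀ ε two_ne_zero] at this
  · have := measure_compl_le_of_one_sub_le hB hε2.le hB' hνL
    rwa [mul_div_cancel₀ ε two_ne_zero] at this
  · rintro ⟨x, y⟩ ⟨hx, hy⟩
    rw [ContinuousWithinAt, Filter.tendsto_def]
    intro s hs
    obtain ⟨U, V, hU, hxU, hV, hyV, hUV⟩ := key ⟨x, hKA hx⟩ ⟨y, hLB hy⟩ s hs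
    obtain ⟨U', hU', hxU', hUU⟩ := hKo U hU _ hxU hx
    obtain ⟨V', hV', hyV', hVV⟩ := hLo V hV _ hyV hy
    refine mem_nhdsWithin.2 ⟨U' ×ˢ V', hU'.prod hV', ⟨hxU', hyV'⟩, ?_⟩
    rintro ⟨x', y'⟩ ⟨⟨hx1, hy1⟩, hx2, hy2⟩
    exact hUV (⟨x', hKA hx2⟩, ⟨y', hLB hy2⟩)
      ⟨hUU _ ⟨hx1, hx2⟩, hVV _ ⟨hy1, hy2⟩⟩

end Structure

/-! ### Transfer to measures with marginals dominated by `μ` and `ν` -/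

section Transfer

open Set Topology

variable {X Y : Type*} [MeasurableSpace X] [MeasurableSpace Y]
    {μ : Measure X} {ν : Measure Y} {κ : Measure (X × Y)} {c : ℝ≥0∞}

/-- A point outside `K ×ˢ L` misses `K` or `L`, and each of these events is measured by one
marginal. -/
theorem measure_compl_prod_le (h1 : κ.map Prod.fst ≤ c • μ) (h2 : κ.map Prod.snd ≤ c • ν)
    (K : Set X) (L : Set Y) : κ (K ×ˢ L)ᶜ ≤ c * (μ Kᶜ + ν Lᶜ) := by
  calc κ (K ×ˢ L)ᶜ ≤ κ (Prod.fst ⁻¹' Kᶜ ∪ Prod.snd ⁻¹' Lᶜ) := measure_mono fun z hz => by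
        by_cases h : z.1 ∈ K
        · exact Or.inr fun h' => hz ⟨h, h'⟩
        · exact Or.inl h
    _ ≤ κ (Prod.fst ⁻¹' Kᶜ) + κ (Prod.snd ⁻¹' Lᶜ) := measure_union_le _ _
    _ ≤ κ.map Prod.fst Kᶜ + κ.map Prod.snd Lᶜ :=
        add_le_add (Measure.le_map_apply measurable_fst.aemeasurable _)
          (Measure.le_map_apply measurable_snd.aemeasurable _)
    _ ≤ (c • μ) Kᶜ + (c • ν) Lᶜ := add_le_add (h1 _) (h2 _)
    _ = _ := by simp [mul_add]

/-- The part of `S` outside `K ×ˢ L` has mass at most `2 * c * ε`, which tends to zero since `c` is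
finite. -/
theorem measure_eq_zero_of_forall_inter_prod (h1 : κ.map Prod.fst ≤ c • μ)
    (h2 : κ.map Prod.snd ≤ c • ν) (hc : c ≠ ∞) {S : Set (X × Y)}
    (h : ∀ ε : ℝ, 0 < ε → ∃ (K : Set X) (L : Set Y), μ Kᶜ ≤ ENNReal.ofReal ε ∧
      ν Lᶜ ≤ ENNReal.ofReal ε ∧ κ (S ∩ K ×ˢ L) = 0) : κ S = 0 := by
  have hle : ∀ ε : ℝ≥0, 0 < ε → κ S ≤ 2 * c * ε := by
    intro ε hε
    obtain ⟨K, L, hK, hL, h0⟩ := h ε (by exact_mod_cast hε)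
    rw [ENNReal.ofReal_coe_nnreal] at hK hL
    calc κ S ≤ κ (S ∩ K ×ˢ L) + κ (S \ K ×ˢ L) := measure_le_inter_add_sdiff _ _ _
      _ ≤ 0 + κ (K ×ˢ L)ᶜ := add_le_add h0.le (measure_mono fun z hz => hz.2)
      _ ≤ c * (μ Kᶜ + ν Lᶜ) := by rw [zero_add]; exact measure_compl_prod_le h1 h2 K L
      _ ≤ c * (ε + ε) := by gcongr
      _ = 2 * c * ε := by ring
  have hlim : Filter.Tendsto (fun ε : ℝ≥0 => 2 * c * (ε : ℝ≥0∞)) (𝓝[>] 0) (𝓝 (2 * c * 0)) := by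
    refine ENNReal.Tendsto.const_mul ?_ (Or.inr (ENNReal.mul_ne_top (by simp) hc))
    exact (ENNReal.tendsto_coe.2 Filter.tendsto_id).mono_left nhdsWithin_le_nhds
  rw [mul_zero] at hlim
  exact le_antisymm (ge_of_tendsto hlim (eventually_mem_nhdsWithin.mono hle)) zero_le

/-- One side of a product-null rectangle is null, and a null side is seen by a marginal. General
product-null sets, such as a diagonal, can carry `κ`; this is why all null sets below are cut into
rectangles. -/
theorem measure_prod_eq_zero_of_prod_eq_zero [SFinite ν] (h1 : κ.map Prod.fst ≤ c • μ)
    (h2 : κ.map Prod.snd ≤ c • ν) {A : Set X} {B : Set Y}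
    (h : (μ.prod ν) (A ×ˢ B) = 0) : κ (A ×ˢ B) = 0 := by
  rw [Measure.prod_prod, mul_eq_zero] at h
  refine le_antisymm ?_ zero_le
  rcases h with h | h
  · calc κ (A ×ˢ B) ≤ κ (Prod.fst ⁻¹' A) := measure_mono fun z hz => hz.1
      _ ≤ κ.map Prod.fst A := Measure.le_map_apply measurable_fst.aemeasurable _
      _ ≤ (c • μ) A := h1 A
      _ = 0 := by simp [h]
  · calc κ (A ×ˢ B) ≤ κ (Prod.snd ⁻¹' B) := measure_mono fun z hz => hz.2
      _ ≤ κ.map Prod.snd B := Measure.le_map_apply measurable_snd.aemeasurable _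
      _ ≤ (c • ν) B := h2 B
      _ = 0 := by simp [h]

theorem lintegral_add_le_of_marginal_le (h1 : κ.map Prod.fst ≤ c • μ)
    (h2 : κ.map Prod.snd ≤ c • ν) {a : X → ℝ≥0} {b : Y → ℝ≥0} (ha : Measurable a)
    (hb : Measurable b) :
    ∫⁻ z, ((a z.1 : ℝ≥0∞) + b z.2) ∂κ ≤ c * (∫⁻ x, a x ∂μ + ∫⁻ y, b y ∂ν) := by
  rw [lintegral_add_left (by fun_prop), mul_add]
  refine add_le_add ?_ ?_
  · rw [← lintegral_map (f := fun x => (a x : ℝ≥0∞)) ha.coe_nnreal_ennreal measurable_fst]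
    refine (lintegral_mono' h1 le_rfl).trans (le_of_eq ?_)
    rw [lintegral_smul_measure, smul_eq_mul]
  · rw [← lintegral_map (f := fun y => (b y : ℝ≥0∞)) hb.coe_nnreal_ennreal measurable_snd]
    refine (lintegral_mono' h2 le_rfl).trans (le_of_eq ?_)
    rw [lintegral_smul_measure, smul_eq_mul]

variable [StandardBorelSpace X] [StandardBorelSpace Y]
    [IsProbabilityMeasure μ] [IsProbabilityMeasure ν]

/-- Almost everywhere bounds of a properly virtually continuous function by a sum `a(x) + b(y)`
transfer to every measure with dominated marginals. -/
theorem ProperlyVirtuallyContinuous.ae_le_add {f : X × Y → ℝ}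
    (hf : ProperlyVirtuallyContinuous μ ν f) (h1 : κ.map Prod.fst ≤ c • μ)
    (h2 : κ.map Prod.snd ≤ c • ν) (hc : c ≠ ∞) {a : X → ℝ} {b : Y → ℝ}
    (h : ∀ᵐ z ∂(μ.prod ν), f z ≤ a z.1 + b z.2) : ∀ᵐ z ∂κ, f z ≤ a z.1 + b z.2 := by
  rw [ae_iff] at h ⊢
  simp only [not_le] at h ⊢
  refine measure_eq_zero_of_forall_inter_prod h1 h2 hc fun ε hε => ?_
  obtain ⟨tX, tY, K, L, pX, bX, pY, bY, hK, hL, hμ, hν, hcont⟩ := hf.exists_compact hε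
  refine ⟨K, L, hμ, hν, ?_⟩
  -- Countably many data: rational thresholds `q`, `r` and a basic rectangle on which `q + r < f`
  -- inside `K ×ˢ L`. Cutting it down to `a < q` and `b < r` gives a rectangle inside the
  -- product-null bad set, and these rectangles cover the bad set within `K ×ˢ L`.
  let I := {i : (ℚ × ℚ) × countableBasis X × countableBasis Y |
    ∀ z ∈ ((i.2.1 : Set X) ×ˢ (i.2.2 : Set Y)) ∩ K ×ˢ L, (i.1.1 : ℝ) + i.1.2 < f z}
  have : Countable (countableBasis X) := countable_countableBasis X
  have : Countable (countableBasis Y) := countable_countableBasis Y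
  refine measure_mono_null (t := ⋃ i : I, ((i.1.2.1 : Set X) ∩ K ∩ {x | a x < i.1.1.1}) ×ˢ
    ((i.1.2.2 : Set Y) ∩ L ∩ {y | b y < i.1.1.2})) ?_ ?_
  · rintro ⟨x, y⟩ ⟨hS : a x + b y < f (x, y), hx, hy⟩
    -- Each threshold uses less than half of the gap `f - a - b`, so that `q + r` stays below `f`.
    obtain ⟨q, hq1, hq2⟩ := exists_rat_btwn
      (show a x < a x + (f (x, y) - a x - b y) / 2 by linarith)
    obtain ⟨r, hr1, hr2⟩ := exists_rat_btwn
      (show b y < b y + (f (x, y) - a x - b y) / 2 by linarith)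
    have hqr : (q : ℝ) + r < f (x, y) := by linarith
    have hmem := hcont (x, y) ⟨hx, hy⟩ (Ioi_mem_nhds hqr)
    obtain ⟨O, hO, hxO, hOs⟩ := mem_nhdsWithin.1 hmem
    obtain ⟨_, ⟨u, hu, v, hv, rfl⟩, hxy, huv⟩ :=
      ((isBasis_countableBasis X).prod (isBasis_countableBasis Y)).exists_subset_of_mem_open hxO hO
    refine mem_iUnion.2 ⟨⟨((q, r), ⟨u, hu⟩, ⟨v, hv⟩), ?_⟩, ⟨⟨hxy.1, hx⟩, hq1⟩, ⟨hxy.2, hy⟩, hr1⟩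
    intro z hz
    exact hOs ⟨huv hz.1, hz.2⟩
  · refine measure_iUnion_null fun i => measure_prod_eq_zero_of_prod_eq_zero h1 h2 ?_
    refine measure_mono_null ?_ h
    rintro ⟨x, y⟩ ⟨⟨⟨hx1, hx2⟩, hx3⟩, ⟨hy1, hy2⟩, hy3⟩
    have := i.2 (x, y) ⟨⟨hx1, hy1⟩, hx2, hy2⟩
    change a x < _ at hx3
    change b y < _ at hy3
    change a x + b y < f (x, y)
    linarith

theorem ProperlyVirtuallyContinuous.ae_abs_le_add {f : X × Y → ℝ}
    (hf : ProperlyVirtuallyContinuous μ ν f) (h1 : κ.map Prod.fst ≤ c • μ)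
    (h2 : κ.map Prod.snd ≤ c • ν) (hc : c ≠ ∞) {a : X → ℝ} {b : Y → ℝ}
    (h : ∀ᵐ z ∂(μ.prod ν), |f z| ≤ a z.1 + b z.2) : ∀ᵐ z ∂κ, |f z| ≤ a z.1 + b z.2 := by
  have hp := hf.ae_le_add h1 h2 hc (h.mono fun z hz => (abs_le.1 hz).2)
  have hn := (hf.const_smul (-1)).ae_le_add h1 h2 hc
    (h.mono fun z hz => show (-1 : ℝ) • f z ≤ a z.1 + b z.2 by
      rw [neg_one_smul]; linarith [(abs_le.1 hz).1])
  filter_upwards [hp, hn] with z hz1 hz2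
  change (-1 : ℝ) • f z ≤ _ at hz2
  rw [neg_one_smul] at hz2
  exact abs_le.2 ⟨by linarith, hz1⟩

/-- The transfer of bounds applied to `f - g` with `a = b = 0`; it makes integrals independent of
the representative. -/
theorem ProperlyVirtuallyContinuous.ae_eq {f g : X × Y → ℝ}
    (hf : ProperlyVirtuallyContinuous μ ν f) (hg : ProperlyVirtuallyContinuous μ ν g)
    (h1 : κ.map Prod.fst ≤ c • μ) (h2 : κ.map Prod.snd ≤ c • ν) (hc : c ≠ ∞)
    (h : f =ᵐ[μ.prod ν] g) : f =ᵐ[κ] g := by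
  have := (hf.add (hg.const_smul (-1))).ae_abs_le_add h1 h2 hc (a := 0) (b := 0)
    (h.mono fun z hz => by simp [hz])
  filter_upwards [this] with z hz
  simp only [Pi.add_apply, Pi.smul_apply, Pi.zero_apply, add_zero, abs_nonpos_iff] at hz
  rw [neg_one_smul] at hz
  linarith

/-- Measurability modulo product-null sets says nothing about a singular `κ`. It comes instead from
continuity on countably many compact rectangles that exhaust `κ`. -/
theorem ProperlyVirtuallyContinuous.aemeasurable {f : X × Y → ℝ}
    (hf : ProperlyVirtuallyContinuous μ ν f) (h1 : κ.map Prod.fst ≤ c • μ)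
    (h2 : κ.map Prod.snd ≤ c • ν) (hc : c ≠ ∞) : AEMeasurable f κ := by
  have key : ∀ n : ℕ, ∃ (K : Set X) (L : Set Y), μ Kᶜ ≤ ENNReal.ofReal (1 / (n + 1)) ∧
      ν Lᶜ ≤ ENNReal.ofReal (1 / (n + 1)) ∧ AEMeasurable f (κ.restrict (K ×ˢ L)) := by
    intro n
    obtain ⟨tX, tY, K, L, pX, bX, pY, bY, hK, hL, hμ, hν, hcont⟩ :=
      hf.exists_compact (Nat.one_div_pos_of_nat (α := ℝ) (n := n))
    exact ⟨K, L, hμ, hν, hcont.aemeasurable (hK.measurableSet.prod hL.measurableSet)⟩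
  choose K L hK hL hm using key
  have h0 : κ (⋃ n, K n ×ˢ L n)ᶜ = 0 := by
    refine measure_eq_zero_of_forall_inter_prod h1 h2 hc fun ε hε => ?_
    obtain ⟨n, hn⟩ := exists_nat_one_div_lt hε
    refine ⟨K n, L n, (hK n).trans (ENNReal.ofReal_le_ofReal hn.le),
      (hL n).trans (ENNReal.ofReal_le_ofReal hn.le), ?_⟩
    convert! measure_empty (μ := κ)
    rw [eq_empty_iff_forall_notMem]
    rintro z ⟨hz, hz'⟩
    exact hz (mem_iUnion.2 ⟨n, hz'⟩)
  rw [← Measure.restrict_eq_self_of_ae_mem (s := ⋃ n, K n ×ˢ L n) h0]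
  exact aemeasurable_iUnion_iff.2 hm

/-- The `L¹(κ)` norm of a properly virtually continuous function is controlled by its regulator
norm, for every measure `κ` with dominated marginals. -/
theorem ProperlyVirtuallyContinuous.lintegral_enorm_le {f : X × Y → ℝ}
    (hf : ProperlyVirtuallyContinuous μ ν f) (h1 : κ.map Prod.fst ≤ c • μ)
    (h2 : κ.map Prod.snd ≤ c • ν) (hc : c ≠ ∞) (hfin : srNorm μ ν f ≠ ∞) :
    ∫⁻ z, ‖f z‖ₑ ∂κ ≤ c * srNorm μ ν f := by
  have key : ∀ d, srNorm μ ν f < d → ∫⁻ z, ‖f z‖ₑ ∂κ ≤ c * d := by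
    intro d hd
    obtain ⟨a, b, ha, hb, hab, hlt⟩ := exists_of_srNorm_lt hd
    have hab' := hf.ae_abs_le_add h1 h2 hc (a := fun x => a x) (b := fun y => b y) hab
    calc ∫⁻ z, ‖f z‖ₑ ∂κ ≤ ∫⁻ z, ((a z.1 : ℝ≥0∞) + b z.2) ∂κ := by
          refine lintegral_mono_ae ?_
          filter_upwards [hab'] with z hz
          rw [← ENNReal.coe_add, enorm_eq_nnnorm, ENNReal.coe_le_coe, ← NNReal.coe_le_coe]
          simpa using hz
      _ ≤ c * (∫⁻ x, a x ∂μ + ∫⁻ y, b y ∂ν) := lintegral_add_le_of_marginal_le h1 h2 ha hb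
      _ ≤ c * d := by gcongr
  -- The infimum need not be attained, so `d` decreases to it; finiteness of the norm provides such
  -- `d`.
  have hlim : Filter.Tendsto (fun d : ℝ≥0∞ => c * d) (𝓝[>] (srNorm μ ν f))
      (𝓝 (c * srNorm μ ν f)) :=
    (ENNReal.Tendsto.const_mul Filter.tendsto_id (Or.inr hc)).mono_left nhdsWithin_le_nhds
  have : (𝓝[>] (srNorm μ ν f)).NeBot := nhdsGT_neBot_of_exists_gt ⟨∞, hfin.lt_top⟩
  exact ge_of_tendsto hlim (eventually_mem_nhdsWithin.mono key)

end Transfer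

/-! ### The pairing of `QB^∞` with `VC¹` -/

section Pairing

variable {X Y : Type*} [MeasurableSpace X] [MeasurableSpace Y]
    {μ : Measure X} {ν : Measure Y} [IsProbabilityMeasure μ] [IsProbabilityMeasure ν]

theorem QBInfty.map_fst_le (η : QBInfty μ ν) :
    η.1.variation.map Prod.fst ≤ qbNorm μ ν η.1 • μ := (qb_iff.1 ⟨η.2.1, le_rfl⟩).1

theorem QBInfty.map_snd_le (η : QBInfty μ ν) :
    η.1.variation.map Prod.snd ≤ qbNorm μ ν η.1 • ν := (qb_iff.1 ⟨η.2.1, le_rfl⟩).2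

/-- A properly virtually continuous representative of an element of `VC¹`. -/
noncomputable def VC1.rep (f : VC1 μ ν) : X × Y → ℝ := f.2.1.choose

theorem VC1.properlyVirtuallyContinuous_rep (f : VC1 μ ν) :
    ProperlyVirtuallyContinuous μ ν (VC1.rep f) := f.2.1.choose_spec.1

theorem VC1.ae_eq_rep (f : VC1 μ ν) : f.1 =ᵐ[μ.prod ν] (VC1.rep f) := f.2.1.choose_spec.2

theorem VC1.srNorm_eq_of_ae_eq (f : VC1 μ ν) {g : X × Y → ℝ} (h : f.1 =ᵐ[μ.prod ν] g) :
    srNorm μ ν g = ENNReal.ofReal ‖f‖ := by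
  rw [VC1.norm_def, ENNReal.ofReal_toReal f.2.2.ne, srNorm_congr h]

variable [StandardBorelSpace X] [StandardBorelSpace Y]

theorem QBInfty.ae_eq (η : QBInfty μ ν) {f g : X × Y → ℝ}
    (hf : ProperlyVirtuallyContinuous μ ν f) (hg : ProperlyVirtuallyContinuous μ ν g)
    (h : f =ᵐ[μ.prod ν] g) : f =ᵐ[η.1.variation] g :=
  hf.ae_eq hg (QBInfty.map_fst_le η) (QBInfty.map_snd_le η) η.2.2.ne h

theorem QBInfty.lintegral_enorm_le (η : QBInfty μ ν) {f : X × Y → ℝ}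
    (hf : ProperlyVirtuallyContinuous μ ν f) (hfin : srNorm μ ν f ≠ ∞) :
    ∫⁻ z, ‖f z‖ₑ ∂η.1.variation ≤ qbNorm μ ν η.1 * srNorm μ ν f :=
  hf.lintegral_enorm_le (QBInfty.map_fst_le η) (QBInfty.map_snd_le η) η.2.2.ne hfin

theorem QBInfty.integrable (η : QBInfty μ ν) {f : X × Y → ℝ}
    (hf : ProperlyVirtuallyContinuous μ ν f) (hfin : srNorm μ ν f ≠ ∞) :
    η.1.Integrable f :=
  ⟨(hf.aemeasurable (QBInfty.map_fst_le η) (QBInfty.map_snd_le η) η.2.2.ne).aestronglyMeasurable,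
    (QBInfty.lintegral_enorm_le η hf hfin).trans_lt
      (ENNReal.mul_lt_top η.2.2 hfin.lt_top)⟩

theorem VC1.integrable_rep (η : QBInfty μ ν) (f : VC1 μ ν) : η.1.Integrable (VC1.rep f) :=
  QBInfty.integrable η (VC1.properlyVirtuallyContinuous_rep f)
    (by rw [VC1.srNorm_eq_of_ae_eq f (VC1.ae_eq_rep f)]; exact ENNReal.ofReal_ne_top)

/-- The functional on `VC¹` induced by a quasi-bistochastic signed measure. -/
noncomputable def pairingLM (η : QBInfty μ ν) : VC1 μ ν →ₗ[ℝ] ℝ where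
  toFun f := ∫ᵛ z, VC1.rep f z ∂•η.1
  map_add' f g := by
    rw [← VectorMeasure.integral_fun_add (VC1.integrable_rep η f) (VC1.integrable_rep η g)]
    -- `VC1.rep` is an arbitrary choice and not additive, but the two sides agree product-almost
    -- everywhere, hence almost everywhere for the variation of `η`.
    refine VectorMeasure.integral_congr_ae (QBInfty.ae_eq η
      (VC1.properlyVirtuallyContinuous_rep (f + g))
      ((VC1.properlyVirtuallyContinuous_rep f).add (VC1.properlyVirtuallyContinuous_rep g)) ?_)
    exact (VC1.ae_eq_rep (f + g)).symm.trans
      ((AEEqFun.coeFn_add f.1 g.1).trans ((VC1.ae_eq_rep f).add (VC1.ae_eq_rep g)))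
  map_smul' r f := by
    rw [RingHom.id_apply, smul_eq_mul, ← smul_eq_mul, ← VectorMeasure.integral_fun_smul]
    refine VectorMeasure.integral_congr_ae (QBInfty.ae_eq η
      (VC1.properlyVirtuallyContinuous_rep (r • f))
      ((VC1.properlyVirtuallyContinuous_rep f).const_smul r) ?_)
    exact (VC1.ae_eq_rep (r • f)).symm.trans
      ((AEEqFun.coeFn_smul r f.1).trans ((VC1.ae_eq_rep f).const_smul r))

theorem pairingLM_apply_of_ae_eq (η : QBInfty μ ν) (f : VC1 μ ν) {g : X × Y → ℝ}
    (hg : ProperlyVirtuallyContinuous μ ν g) (h : f.1 =ᵐ[μ.prod ν] g) :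
    pairingLM η f = ∫ᵛ z, g z ∂•η.1 :=
  VectorMeasure.integral_congr_ae
    (QBInfty.ae_eq η (VC1.properlyVirtuallyContinuous_rep f) hg ((VC1.ae_eq_rep f).symm.trans h))

theorem norm_pairingLM_le (η : QBInfty μ ν) (f : VC1 μ ν) : ‖pairingLM η f‖ ≤ ‖η‖ * ‖f‖ := by
  have hs := VC1.srNorm_eq_of_ae_eq f (VC1.ae_eq_rep f)
  have hne : srNorm μ ν (VC1.rep f) ≠ ∞ := by rw [hs]; exact ENNReal.ofReal_ne_top
  have h1 : ‖pairingLM η f‖ₑ ≤ qbNorm μ ν η.1 * srNorm μ ν (VC1.rep f) := by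
    refine (VectorMeasure.enorm_integral_le_lintegral_enorm.trans ?_).trans
      (QBInfty.lintegral_enorm_le η (VC1.properlyVirtuallyContinuous_rep f) hne)
    grw [ContinuousLinearMap.opENorm_lsmul_le, one_mul]
  have h2 := ENNReal.toReal_mono (ENNReal.mul_ne_top η.2.2.ne hne) h1
  rwa [ENNReal.toReal_mul, hs, ENNReal.toReal_ofReal (norm_nonneg _), toReal_enorm] at h2

/-- The pairing as a linear map from `QB^∞` to the dual of `VC¹`. -/
noncomputable def pairing : QBInfty μ ν →ₗ[ℝ] StrongDual ℝ (VC1 μ ν) where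
  toFun η := (pairingLM η).mkContinuous ‖η‖ (norm_pairingLM_le η)
  map_add' η ξ := by
    ext f
    simp only [add_apply, LinearMap.mkContinuous_apply]
    exact VectorMeasure.integral_add_vectorMeasure (VC1.integrable_rep η f) (VC1.integrable_rep ξ f)
  map_smul' r η := by
    ext f
    simp only [smul_apply, LinearMap.mkContinuous_apply, RingHom.id_apply]
    exact VectorMeasure.integral_smul_vectorMeasure _ r

theorem pairing_apply_of_ae_eq (η : QBInfty μ ν) (f : VC1 μ ν) {g : X × Y → ℝ}
    (hg : ProperlyVirtuallyContinuous μ ν g) (h : f.1 =ᵐ[μ.prod ν] g) :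
    pairing η f = ∫ᵛ z, g z ∂•η.1 := pairingLM_apply_of_ae_eq η f hg h

theorem norm_pairing_le (η : QBInfty μ ν) : ‖pairing η‖ ≤ ‖η‖ :=
  LinearMap.mkContinuous_norm_le _ (norm_nonneg _) (norm_pairingLM_le η)

end Pairing

/-! ### The algebra of rectangles and step functions -/

section Rect

open Set Topology

/-- The algebra of sets generated by the measurable rectangles. -/
def rectAlgebra (X Y : Type*) [MeasurableSpace X] [MeasurableSpace Y] : Set (Set (X × Y)) :=
  generateSetAlgebra (image2 (· ×ˢ ·) {s | MeasurableSet s} {t | MeasurableSet t})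

variable {X Y : Type*} [MeasurableSpace X] [MeasurableSpace Y]

theorem isSetAlgebra_rectAlgebra : IsSetAlgebra (rectAlgebra X Y) :=
  isSetAlgebra_generateSetAlgebra

theorem generateFrom_rectAlgebra :
    (inferInstance : MeasurableSpace (X × Y)) = MeasurableSpace.generateFrom (rectAlgebra X Y) := by
  rw [rectAlgebra, generateFrom_generateSetAlgebra_eq, generateFrom_prod]

theorem measurableSet_of_mem_rectAlgebra {S : Set (X × Y)} (hS : S ∈ rectAlgebra X Y) :
    MeasurableSet S := by
  have := MeasurableSpace.measurableSet_generateFrom hS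
  rwa [← generateFrom_rectAlgebra] at this

theorem prod_mem_rectAlgebra {A : Set X} {B : Set Y} (hA : MeasurableSet A)
    (hB : MeasurableSet B) : A ×ˢ B ∈ rectAlgebra X Y :=
  self_subset_generateSetAlgebra ⟨A, hA, B, hB, rfl⟩

theorem lintegral_coe_indicator_const {Z : Type*} [MeasurableSpace Z] {m : Measure Z} {E : Set Z}
    (hE : MeasurableSet E) (c : ℝ≥0) :
    ∫⁻ x, ((E.indicator (fun _ => c) x : ℝ≥0) : ℝ≥0∞) ∂m = c * m E := by
  rw [← lintegral_indicator_const hE]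
  congr 1 with x
  by_cases hx : x ∈ E <;> simp [hx]

variable {μ : Measure X} {ν : Measure Y}

theorem ProperlyVirtuallyContinuous.mul [IsProbabilityMeasure μ] [IsProbabilityMeasure ν]
    {f g : X × Y → ℝ} (hf : ProperlyVirtuallyContinuous μ ν f)
    (hg : ProperlyVirtuallyContinuous μ ν g) : ProperlyVirtuallyContinuous μ ν (f * g) := by
  refine ⟨hf.1.mul hg.1, fun ε hε => ?_⟩
  obtain ⟨A, B, hA, hB, hA', hB', ρA, ρB, aA, aB, hc⟩ := hf.2 (ε / 2) (by positivity)
  obtain ⟨C, D, hC, hD, hC', hD', ρC, ρD, aC, aD, hd⟩ := hg.2 (ε / 2) (by positivity)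
  obtain ⟨τ, hτ, c1, c2⟩ := IsAdmissible.inf hA hC aA aC
  obtain ⟨σ, hσ, c3, c4⟩ := IsAdmissible.inf hB hD aB aD
  refine ⟨A ∩ C, B ∩ D, hA.inter hC, hB.inter hD, real_inter_ge hC hA' hC',
    real_inter_ge hD hB' hD', τ, σ, hτ, hσ, ?_⟩
  exact (hc.comp (c1.prodMap c3)).mul (hd.comp (c2.prodMap c4))

/-- The metric of `ℝ` pulled back along `φ` is measurable and separable. -/
theorem exists_isAdmissible_continuous {Z : Type*} [MeasurableSpace Z] (m : Measure Z)
    {φ : Z → ℝ} (hφ : Measurable φ) :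
    ∃ ρ : PseudoMetricSpace Z, IsAdmissible m ρ ∧ Continuous φ := by
  let ρ : PseudoMetricSpace Z := PseudoMetricSpace.induced φ inferInstance
  have hind : IsInducing φ := ⟨rfl⟩
  refine ⟨ρ, ⟨?_, univ, by simp, ?_⟩, hind.continuous⟩
  · exact ((hφ.comp measurable_fst).dist (hφ.comp measurable_snd)).aemeasurable
  · have : SecondCountableTopology Z := hind.secondCountableTopology
    exact IsSeparable.of_separableSpace _

theorem properlyVirtuallyContinuous_mul [IsProbabilityMeasure μ] [IsProbabilityMeasure ν]
    {φ : X → ℝ} {ψ : Y → ℝ} (hφ : Measurable φ) (hψ : Measurable ψ) :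
    ProperlyVirtuallyContinuous μ ν fun z => φ z.1 * ψ z.2 := by
  refine ⟨by fun_prop, fun ε hε => ?_⟩
  obtain ⟨ρ, hρ, hc⟩ := exists_isAdmissible_continuous (μ.comap ((↑) : ↥(univ : Set X) → X))
    (hφ.comp measurable_subtype_coe)
  obtain ⟨σ, hσ, hd⟩ := exists_isAdmissible_continuous (ν.comap ((↑) : ↥(univ : Set Y) → Y))
    (hψ.comp measurable_subtype_coe)
  exact ⟨univ, univ, .univ, .univ, by simp [hε.le], by simp [hε.le], ρ, σ, hρ, hσ,
    (hc.comp continuous_fst).mul (hd.comp continuous_snd)⟩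

theorem properlyVirtuallyContinuous_indicator [IsProbabilityMeasure μ] [IsProbabilityMeasure ν]
    {S : Set (X × Y)} (hS : S ∈ rectAlgebra X Y) :
    ProperlyVirtuallyContinuous μ ν (S.indicator 1) := by
  have hone : ProperlyVirtuallyContinuous μ ν (1 : X × Y → ℝ) := by
    simpa using! properlyVirtuallyContinuous_mul (μ := μ) (ν := ν)
      (measurable_const (a := (1 : ℝ))) (measurable_const (a := (1 : ℝ)))
  have hcompl : ∀ S : Set (X × Y), ProperlyVirtuallyContinuous μ ν (S.indicator 1) →
      ProperlyVirtuallyContinuous μ ν (Sᶜ.indicator 1) := by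
    intro S h
    have := hone.add (h.const_smul (-1))
    convert! this using 1
    rw [indicator_compl, neg_one_smul, sub_eq_add_neg]
  induction hS with
  | base S hS =>
    obtain ⟨A, hA, B, hB, rfl⟩ := hS
    convert! properlyVirtuallyContinuous_mul (μ := μ) (ν := ν)
      (measurable_const.indicator hA : Measurable (A.indicator fun _ => (1 : ℝ)))
      (measurable_const.indicator hB : Measurable (B.indicator fun _ => (1 : ℝ))) using 1
    ext z
    exact indicator_prod_one
  | empty => rw [indicator_empty']; exact .zero
  | compl S _ h => exact hcompl S h
  | union S T _ _ hS hT =>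
    -- De Morgan: products of indicators handle intersections, and complements then handle unions.
    have := (hcompl S hS).mul (hcompl T hT)
    rw [← inter_indicator_one, ← compl_union] at this
    have := hcompl _ this
    rwa [compl_compl] at this

/-- The class in `VC¹` of a properly virtually continuous function with finite norm. -/
noncomputable def VC1.mk [IsProbabilityMeasure μ] [IsProbabilityMeasure ν] (f : X × Y → ℝ)
    (hf : ProperlyVirtuallyContinuous μ ν f) (hfin : srNorm μ ν f < ∞) : VC1 μ ν :=
  ⟨AEEqFun.mk f hf.1.aestronglyMeasurable, ⟨f, hf, AEEqFun.coeFn_mk _ _⟩, by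
    rwa [srNorm_congr (AEEqFun.coeFn_mk f hf.1.aestronglyMeasurable)]⟩

theorem VC1.coe_mk_ae_eq [IsProbabilityMeasure μ] [IsProbabilityMeasure ν] {f : X × Y → ℝ}
    (hf : ProperlyVirtuallyContinuous μ ν f) (hfin : srNorm μ ν f < ∞) :
    (VC1.mk f hf hfin).1 =ᵐ[μ.prod ν] f := AEEqFun.coeFn_mk _ _

/-- The competitor is the indicator of `A` paired with zero. Paying on one side only is what turns
norm bounds on functionals into bounds on a single marginal. -/
theorem srNorm_le_measure_fst {f : X × Y → ℝ} {A : Set X} (hA : MeasurableSet A)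
    (h : ∀ z, |f z| ≤ A.indicator 1 z.1) : srNorm μ ν f ≤ μ A := by
  refine (srNorm_le (a := A.indicator 1) (b := 0) (measurable_one.indicator hA)
    measurable_const (.of_forall fun z => (h z).trans (le_of_eq ?_))).trans (le_of_eq ?_)
  · by_cases hz : z.1 ∈ A <;> simp [hz]
  · simpa using! lintegral_coe_indicator_const hA 1

theorem srNorm_le_measure_snd {f : X × Y → ℝ} {B : Set Y} (hB : MeasurableSet B)
    (h : ∀ z, |f z| ≤ B.indicator 1 z.2) : srNorm μ ν f ≤ ν B := by
  refine (srNorm_le (a := 0) (b := B.indicator 1) measurable_const (measurable_one.indicator hB)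
    (.of_forall fun z => (h z).trans (le_of_eq ?_))).trans (le_of_eq ?_)
  · by_cases hz : z.2 ∈ B <;> simp [hz]
  · simpa using! lintegral_coe_indicator_const hB 1

theorem abs_indicator_one_le_of_subset {Z W : Type*} {S : Set Z} {A : Set W} {π : Z → W}
    (h : S ⊆ π ⁻¹' A) (z : Z) : |S.indicator (1 : Z → ℝ) z| ≤ A.indicator 1 (π z) := by
  by_cases hz : z ∈ S
  · simp [hz, show π z ∈ A from h hz]
  · simp only [hz, not_false_eq_true, indicator_of_notMem, abs_zero]
    exact indicator_nonneg (fun _ _ => zero_le_one) _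

variable (μ ν) in
open Classical in
/-- The class in `VC¹` of the indicator function of a set in the rectangle algebra. -/
noncomputable def rectInd [IsProbabilityMeasure μ] [IsProbabilityMeasure ν] (S : Set (X × Y)) :
    VC1 μ ν :=
  if hS : S ∈ rectAlgebra X Y then
    VC1.mk (S.indicator 1) (properlyVirtuallyContinuous_indicator hS)
      ((srNorm_le_measure_fst .univ
        (abs_indicator_one_le_of_subset (subset_univ _))).trans_lt (measure_lt_top _ _))
  else 0

variable [IsProbabilityMeasure μ] [IsProbabilityMeasure ν]

theorem rectInd_ae_eq {S : Set (X × Y)} (hS : S ∈ rectAlgebra X Y) :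
    (rectInd μ ν S).1 =ᵐ[μ.prod ν] S.indicator 1 := by
  rw [rectInd, dif_pos hS]
  exact VC1.coe_mk_ae_eq _ _

theorem rectInd_union {S T : Set (X × Y)} (hS : S ∈ rectAlgebra X Y) (hT : T ∈ rectAlgebra X Y)
    (h : Disjoint S T) : rectInd μ ν (S ∪ T) = rectInd μ ν S + rectInd μ ν T := by
  refine Subtype.ext (AEEqFun.ext ?_)
  refine (rectInd_ae_eq (isSetAlgebra_rectAlgebra.union_mem hS hT)).trans ?_
  rw [indicator_union_of_disjoint h]
  exact ((rectInd_ae_eq hS).add (rectInd_ae_eq hT)).symm.trans (AEEqFun.coeFn_add _ _).symm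

theorem rectInd_empty : rectInd μ ν (∅ : Set (X × Y)) = 0 := by
  have h := isSetAlgebra_rectAlgebra (X := X) (Y := Y).empty_mem
  have := rectInd_union (μ := μ) (ν := ν) h h (disjoint_empty _)
  rw [union_empty] at this
  simpa using this

theorem VC1.norm_le_of_ae_eq (f : VC1 μ ν) {g : X × Y → ℝ} (h : f.1 =ᵐ[μ.prod ν] g) {c : ℝ≥0∞}
    (hg : srNorm μ ν g ≤ c) (hc : c ≠ ∞) : ‖f‖ ≤ c.toReal := by
  rw [VC1.norm_def, srNorm_congr h]
  exact ENNReal.toReal_mono hc hg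

theorem norm_rectInd_le_fst {S : Set (X × Y)} (hS : S ∈ rectAlgebra X Y) {A : Set X}
    (hA : MeasurableSet A) (h : S ⊆ Prod.fst ⁻¹' A) : ‖rectInd μ ν S‖ ≤ μ.real A :=
  VC1.norm_le_of_ae_eq _ (rectInd_ae_eq hS)
    (srNorm_le_measure_fst hA (abs_indicator_one_le_of_subset h)) (measure_ne_top _ _)

theorem norm_rectInd_le_snd {S : Set (X × Y)} (hS : S ∈ rectAlgebra X Y) {B : Set Y}
    (hB : MeasurableSet B) (h : S ⊆ Prod.snd ⁻¹' B) : ‖rectInd μ ν S‖ ≤ ν.real B :=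
  VC1.norm_le_of_ae_eq _ (rectInd_ae_eq hS)
    (srNorm_le_measure_snd hB (abs_indicator_one_le_of_subset h)) (measure_ne_top _ _)

end Rect

/-! ### Density of step functions -/

section Density

open Set Topology

variable (X Y : Type*) [MeasurableSpace X] [MeasurableSpace Y]

/-- The space of step functions on the rectangle algebra. -/
def stepFun : Submodule ℝ (X × Y → ℝ) :=
  Submodule.span ℝ ((fun S : Set (X × Y) => S.indicator 1) '' rectAlgebra X Y)

variable {X Y}

theorem indicator_one_mem_stepFun {S : Set (X × Y)} (hS : S ∈ rectAlgebra X Y) :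
    S.indicator 1 ∈ stepFun X Y := Submodule.subset_span ⟨S, hS, rfl⟩

theorem indicator_mem_stepFun {S : Set (X × Y)} (hS : S ∈ rectAlgebra X Y) {s : X × Y → ℝ}
    (hs : s ∈ stepFun X Y) : S.indicator s ∈ stepFun X Y := by
  induction hs using Submodule.span_induction with
  | mem s hs =>
    obtain ⟨T, hT, rfl⟩ := hs
    rw [indicator_indicator]
    exact indicator_one_mem_stepFun (isSetAlgebra_rectAlgebra.inter_mem hS hT)
  | zero => rw [indicator_zero']; exact zero_mem _
  | add s t _ _ hs ht => rw [indicator_add']; exact add_mem hs ht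
  | smul c s _ hs =>
    have : S.indicator (c • s) = c • S.indicator s := indicator_const_smul S c s
    rw [this]
    exact Submodule.smul_mem _ _ hs

/-- Continuous functions on a product of compact sets are uniform limits of step functions. -/
theorem exists_stepFun_of_continuousOn [TopologicalSpace X] [TopologicalSpace Y]
    [OpensMeasurableSpace X] [OpensMeasurableSpace Y] {f : X × Y → ℝ} {C : Set (X × Y)}
    (hC : IsCompact C) (hf : ContinuousOn f C) {ε : ℝ} (hε : 0 < ε) :
    ∃ s ∈ stepFun X Y, ∀ z ∈ C, |f z - s z| ≤ ε := by
  -- Asking for the approximation on a set `R` of the algebra allows gluing: `s` is used on `R` and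
  -- `s'` off it, so compact induction applies.
  suffices ∃ R ∈ rectAlgebra X Y, C ⊆ R ∧ ∃ s ∈ stepFun X Y, ∀ z ∈ R ∩ C, |f z - s z| ≤ ε by
    obtain ⟨R, -, hCR, s, hs, h⟩ := this
    exact ⟨s, hs, fun z hz => h z ⟨hCR hz, hz⟩⟩
  refine hC.induction_on (p := fun E => ∃ R ∈ rectAlgebra X Y, E ⊆ R ∧
    ∃ s ∈ stepFun X Y, ∀ z ∈ R ∩ C, |f z - s z| ≤ ε) ?_ ?_ ?_ ?_
  · exact ⟨∅, isSetAlgebra_rectAlgebra.empty_mem, subset_rfl, 0, zero_mem _, by simp⟩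
  · rintro E F hEF ⟨R, hR, hFR, h⟩
    exact ⟨R, hR, hEF.trans hFR, h⟩
  · rintro E F ⟨R, hR, hER, s, hs, h⟩ ⟨R', hR', hFR', s', hs', h'⟩
    refine ⟨R ∪ R', isSetAlgebra_rectAlgebra.union_mem hR hR', union_subset_union hER hFR',
      R.indicator s + Rᶜ.indicator s', add_mem (indicator_mem_stepFun hR hs)
        (indicator_mem_stepFun (isSetAlgebra_rectAlgebra.compl_mem hR) hs'), ?_⟩
    rintro z ⟨hz, hzC⟩
    by_cases hzR : z ∈ R
    · simpa [hzR] using h z ⟨hzR, hzC⟩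
    · simpa [hzR] using h' z ⟨hz.resolve_left hzR, hzC⟩
  · intro z hz
    have hball := hf z hz (Metric.closedBall_mem_nhds (f z) hε)
    obtain ⟨O, hO, hzO, hOC⟩ := mem_nhdsWithin.1 hball
    obtain ⟨u, v, hu, hzu, hv, hzv, huv⟩ := mem_nhds_prod_iff'.1 (hO.mem_nhds hzO)
    refine ⟨u ×ˢ v, mem_nhdsWithin_of_mem_nhds ((hu.prod hv).mem_nhds ⟨hzu, hzv⟩), u ×ˢ v,
      prod_mem_rectAlgebra hu.measurableSet hv.measurableSet, subset_rfl, f z • univ.indicator 1,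
      Submodule.smul_mem _ _ (indicator_one_mem_stepFun isSetAlgebra_rectAlgebra.univ_mem), ?_⟩
    rintro w ⟨hw, hwC⟩
    have := hOC ⟨huv hw, hwC⟩
    simpa [Real.dist_eq] using this

/-- Dominated convergence: the truncated difference is at most `a` and vanishes at each point for
large `n`. -/
theorem exists_lintegral_sub_le {Z : Type*} [MeasurableSpace Z] {m : Measure Z} {a : Z → ℝ≥0}
    (ha : Measurable a) (hfin : ∫⁻ x, a x ∂m ≠ ∞) {ε : ℝ≥0∞} (hε : 0 < ε) :
    ∃ N : ℕ, ∀ n ≥ N, ∫⁻ x, ((a x - n : ℝ≥0) : ℝ≥0∞) ∂m ≤ ε := by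
  have hlim : Filter.Tendsto (fun n : ℕ => ∫⁻ x, ((a x - n : ℝ≥0) : ℝ≥0∞) ∂m) Filter.atTop
      (𝓝 (∫⁻ _, 0 ∂m)) := by
    refine tendsto_lintegral_of_dominated_convergence (fun x => a x)
      (fun n => (ha.sub_const _).coe_nnreal_ennreal)
      (fun n => .of_forall fun x => ENNReal.coe_le_coe.2 tsub_le_self) hfin
      (.of_forall fun x => ?_)
    refine tendsto_const_nhds.congr' ?_
    obtain ⟨N, hN⟩ := exists_nat_ge (a x)
    filter_upwards [Filter.eventually_ge_atTop N] with n hn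
    have : a x ≤ n := hN.trans (by exact_mod_cast hn)
    simp [tsub_eq_zero_of_le this]
  rw [lintegral_zero] at hlim
  exact Filter.eventually_atTop.1 (hlim.eventually (Iic_mem_nhds hε))

variable {μ : Measure X} {ν : Measure Y} [IsProbabilityMeasure μ] [IsProbabilityMeasure ν]

theorem exists_mem_span_ae_eq_of_mem_stepFun {s : X × Y → ℝ} (hs : s ∈ stepFun X Y) :
    ∃ w ∈ Submodule.span ℝ (rectInd μ ν '' rectAlgebra X Y), w.1 =ᵐ[μ.prod ν] s := by
  induction hs using Submodule.span_induction with
  | mem s hs =>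
    obtain ⟨T, hT, rfl⟩ := hs
    exact ⟨rectInd μ ν T, Submodule.subset_span ⟨T, hT, rfl⟩, rectInd_ae_eq hT⟩
  | zero => exact ⟨0, zero_mem _, AEEqFun.coeFn_zero⟩
  | add s t _ _ hs ht =>
    obtain ⟨w, hw, hws⟩ := hs
    obtain ⟨v, hv, hvt⟩ := ht
    exact ⟨w + v, add_mem hw hv, (AEEqFun.coeFn_add w.1 v.1).trans (hws.add hvt)⟩
  | smul c s _ hs =>
    obtain ⟨w, hw, hws⟩ := hs
    exact ⟨c • w, Submodule.smul_mem _ _ hw,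
      (AEEqFun.coeFn_smul c w.1).trans (hws.const_smul c)⟩

/-- Step functions are dense for the regulator norm among properly virtually continuous
functions of finite norm. -/
theorem ProperlyVirtuallyContinuous.exists_stepFun [StandardBorelSpace X] [StandardBorelSpace Y]
    {f : X × Y → ℝ} (hf : ProperlyVirtuallyContinuous μ ν f) (hfin : srNorm μ ν f < ∞)
    {ε : ℝ≥0} (hε : 0 < ε) : ∃ s ∈ stepFun X Y, srNorm μ ν (f - s) ≤ 5 * ε := by
  obtain ⟨a, b, ha, hb, hab, hlt⟩ := exists_of_srNorm_lt hfin
  obtain ⟨hai, hbi⟩ := ENNReal.add_lt_top.1 hlt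
  have hε' : (0 : ℝ≥0∞) < ε := by exact_mod_cast hε
  obtain ⟨N₁, hN₁⟩ := exists_lintegral_sub_le ha hai.ne hε'
  obtain ⟨N₂, hN₂⟩ := exists_lintegral_sub_le hb hbi.ne hε'
  -- The added one keeps the divisor `2 * M` positive.
  set M : ℕ := max N₁ N₂ + 1
  have hMpos : (0 : ℝ≥0) < 2 * M := by positivity
  have ha' := hN₁ M ((le_max_left _ _).trans (Nat.le_succ _))
  have hb' := hN₂ M ((le_max_right _ _).trans (Nat.le_succ _))
  -- Chosen so that a penalty of `2 * M` on `Kᶜ` or on `Lᶜ` costs at most `ε`.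
  have hδ : (0 : ℝ) < (ε / (2 * M) : ℝ≥0) := NNReal.coe_pos.2 (div_pos hε hMpos)
  obtain ⟨tX, tY, K, L, pX, bX, pY, bY, hK, hL, hμ, hν, hcont⟩ := hf.exists_compact hδ
  rw [ENNReal.ofReal_coe_nnreal] at hμ hν
  have hKm := hK.measurableSet
  have hLm := hL.measurableSet
  obtain ⟨s, hs, hfs⟩ := exists_stepFun_of_continuousOn (hK.prod hL) hcont
    (NNReal.coe_pos.2 hε)
  refine ⟨(K ×ˢ L).indicator s, indicator_mem_stepFun (prod_mem_rectAlgebra hKm hLm) hs, ?_⟩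
  -- On `K ×ˢ L` the error is at most `ε`. Elsewhere the step function is zero and `|f|` is at most
  -- `2 * M` plus the truncated excesses of `a` and `b`; the penalties pay for `2 * M`. The total `5
  -- * ε` is one uniform error, two excesses and two penalties.
  have hA : Measurable fun x => ε + (a x - M) + Kᶜ.indicator (fun _ => 2 * (M : ℝ≥0)) x :=
    ((ha.sub_const _).const_add _).add (measurable_const.indicator hKm.compl)
  have hB : Measurable fun y => (b y - M) + Lᶜ.indicator (fun _ => 2 * (M : ℝ≥0)) y :=
    (hb.sub_const _).add (measurable_const.indicator hLm.compl)
  have hind : ((2 * (M : ℝ≥0) : ℝ≥0) : ℝ≥0∞) * ((ε / (2 * M) : ℝ≥0) : ℝ≥0∞) = ε := by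
    rw [← ENNReal.coe_mul, mul_div_cancel₀ _ hMpos.ne']
  refine (srNorm_le hA hB ?_).trans ?_
  · filter_upwards [hab] with z hz
    have hia : (a z.1 : ℝ) - M ≤ ((a z.1 - M : ℝ≥0) : ℝ) := by
      rw [NNReal.coe_sub_def]; exact le_max_left _ _
    have hib : (b z.2 : ℝ) - M ≤ ((b z.2 - M : ℝ≥0) : ℝ) := by
      rw [NNReal.coe_sub_def]; exact le_max_left _ _
    have h0a := (a z.1 - M : ℝ≥0).coe_nonneg
    have h0b := (b z.2 - M : ℝ≥0).coe_nonneg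
    have hε0 := ε.coe_nonneg
    have hMR : (0 : ℝ) ≤ M := Nat.cast_nonneg _
    by_cases h1 : z.1 ∈ K
    · by_cases h2 : z.2 ∈ L
      · have hzKL : z ∈ K ×ˢ L := ⟨h1, h2⟩
        have := hfs z hzKL
        simp only [Pi.sub_apply, hzKL, h1, h2, indicator_of_mem, mem_compl_iff, not_true_eq_false,
          not_false_eq_true, indicator_of_notMem, NNReal.coe_add, NNReal.coe_zero]
        linarith
      · have hzKL : z ∉ K ×ˢ L := fun h => h2 h.2
        simp only [Pi.sub_apply, hzKL, h1, h2, indicator_of_mem, mem_compl_iff, not_true_eq_false,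
          not_false_eq_true, indicator_of_notMem, NNReal.coe_add, NNReal.coe_zero, sub_zero,
          NNReal.coe_mul, NNReal.coe_natCast, NNReal.coe_ofNat]
        linarith
    · have hzKL : z ∉ K ×ˢ L := fun h => h1 h.1
      have h0 : (0 : ℝ) ≤ ((Lᶜ.indicator (fun _ => 2 * (M : ℝ≥0)) z.2 : ℝ≥0) : ℝ) :=
        NNReal.coe_nonneg _
      simp only [Pi.sub_apply, hzKL, h1, indicator_of_mem, mem_compl_iff,
        not_false_eq_true, indicator_of_notMem, NNReal.coe_add, sub_zero,
        NNReal.coe_mul, NNReal.coe_natCast, NNReal.coe_ofNat]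
      linarith
  · simp only [ENNReal.coe_add]
    have m1 : Measurable fun x => ((a x - M : ℝ≥0) : ℝ≥0∞) := (ha.sub_const _).coe_nnreal_ennreal
    have m2 : Measurable fun y => ((b y - M : ℝ≥0) : ℝ≥0∞) := (hb.sub_const _).coe_nnreal_ennreal
    rw [lintegral_add_left (m1.const_add _), lintegral_add_left measurable_const,
      lintegral_add_left m2, lintegral_const, measure_univ, mul_one]
    rw [lintegral_coe_indicator_const hKm.compl, lintegral_coe_indicator_const hLm.compl]
    grw [ha', hb', hμ, hν, hind]
    exact le_of_eq (by ring)

theorem dense_span_rectInd [StandardBorelSpace X] [StandardBorelSpace Y] :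
    Dense (Submodule.span ℝ (rectInd μ ν '' rectAlgebra X Y) : Set (VC1 μ ν)) := by
  refine Metric.dense_iff.2 fun f r hr => ?_
  -- The approximation error is five times this, which is strictly less than `r`.
  have hε : 0 < (r / 6).toNNReal := Real.toNNReal_pos.2 (by positivity)
  have hfin : srNorm μ ν (VC1.rep f) < ∞ := by
    rw [VC1.srNorm_eq_of_ae_eq f (VC1.ae_eq_rep f)]; exact ENNReal.ofReal_lt_top
  obtain ⟨s, hs, hfs⟩ := (VC1.properlyVirtuallyContinuous_rep f).exists_stepFun hfin hε
  obtain ⟨w, hw, hws⟩ := exists_mem_span_ae_eq_of_mem_stepFun (μ := μ) (ν := ν) hs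
  refine ⟨w, ?_, hw⟩
  have hae : (f - w).1 =ᵐ[μ.prod ν] VC1.rep f - s :=
    (AEEqFun.coeFn_sub f.1 w.1).trans ((VC1.ae_eq_rep f).sub hws)
  have h1 := VC1.norm_le_of_ae_eq (f - w) hae hfs
    (ENNReal.mul_ne_top (by simp) ENNReal.coe_ne_top)
  rw [Metric.mem_ball, dist_comm, dist_eq_norm]
  refine h1.trans_lt ?_
  rw [ENNReal.toReal_mul, ENNReal.coe_toReal, Real.coe_toNNReal _ (by positivity)]
  norm_num
  linarith

end Density

/-! ### The pairing is isometric -/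

section Isometry

open Set Topology
open scoped symmDiff

/-- `P` is the positive set of a Hahn decomposition. -/
theorem SignedMeasure.exists_variation_real_eq_sub {Z : Type*} [MeasurableSpace Z]
    (η : SignedMeasure Z) : ∃ P, MeasurableSet P ∧
      ∀ S, MeasurableSet S → η.variation.real S = η (S ∩ P) - η (S \ P) := by
  obtain ⟨P, hP, hpos, hneg, h1, h2⟩ := η.toJordanDecomposition_spec
  refine ⟨P, hP, fun S hS => ?_⟩
  rw [← SignedMeasure.totalVariation_eq_variation, SignedMeasure.totalVariation,
    measureReal_add_apply, h1, h2, SignedMeasure.toMeasureOfZeroLE_real_apply _ _ _ hS,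
    SignedMeasure.toMeasureOfLEZero_real_apply _ _ _ hS, inter_comm P, inter_comm Pᶜ,
    ← sub_eq_add_neg, sdiff_eq]

theorem SignedMeasure.abs_apply_sub_apply_le {Z : Type*} [MeasurableSpace Z]
    (η : SignedMeasure Z) {S T : Set Z} (hS : MeasurableSet S) (hT : MeasurableSet T) :
    |η S - η T| ≤ η.variation.real (S ∆ T) := by
  have h1 : η S = η (S ∩ T) + η (S \ T) := by
    rw [← VectorMeasure.of_union (disjoint_sdiff_inter.symm) (hS.inter hT) (hS.diff hT),
      inter_union_sdiff]
  have h2 : η T = η (S ∩ T) + η (T \ S) := by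
    rw [inter_comm, ← VectorMeasure.of_union (disjoint_sdiff_inter.symm) (hT.inter hS)
      (hT.diff hS), inter_union_sdiff]
  have h3 : η.variation.real (S ∆ T) = η.variation.real (S \ T) + η.variation.real (T \ S) :=
    measureReal_union disjoint_sdiff_sdiff (hT.diff hS)
  have h4 : ‖η (S \ T)‖ ≤ η.variation.real (S \ T) :=
    VectorMeasure.norm_measure_le_variation (measure_ne_top _ _)
  have h5 : ‖η (T \ S)‖ ≤ η.variation.real (T \ S) :=
    VectorMeasure.norm_measure_le_variation (measure_ne_top _ _)
  rw [h1, h2, h3, add_sub_add_left_eq_sub]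
  exact (abs_sub _ _).trans (add_le_add h4 h5)

variable {X Y : Type*} [MeasurableSpace X] [MeasurableSpace Y]

/-- The Hahn set need not belong to the algebra, but it is within `δ` in variation of some `R` that
does; replacing it by `R` moves each of the two terms by at most `δ`. -/
theorem exists_rectAlgebra_variation_le (η : SignedMeasure (X × Y)) {S : Set (X × Y)}
    (hS : S ∈ rectAlgebra X Y) {δ : ℝ} (hδ : 0 < δ) :
    ∃ T ∈ rectAlgebra X Y, T ⊆ S ∧ η.variation.real S ≤ η T - η (S \ T) + 2 * δ := by
  obtain ⟨P, hP, hPη⟩ := SignedMeasure.exists_variation_real_eq_sub η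
  obtain ⟨R, hR, hlt⟩ := (Measure.MeasureDense.of_generateFrom_isSetAlgebra_finite
    (μ := η.variation) isSetAlgebra_rectAlgebra generateFrom_rectAlgebra).approx P hP
    (measure_ne_top _ _) δ hδ
  have hlt' : η.variation.real (P ∆ R) ≤ δ := ENNReal.toReal_le_of_le_ofReal hδ.le hlt.le
  have hSm := measurableSet_of_mem_rectAlgebra hS
  have hRm := measurableSet_of_mem_rectAlgebra hR
  refine ⟨S ∩ R, isSetAlgebra_rectAlgebra.inter_mem hS hR, inter_subset_left, ?_⟩
  have h1 := SignedMeasure.abs_apply_sub_apply_le η (hSm.inter hP) (hSm.inter hRm)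
  have h2 := SignedMeasure.abs_apply_sub_apply_le η (hSm.diff hP) (hSm.diff hRm)
  have h3 : η.variation.real ((S ∩ P) ∆ (S ∩ R)) ≤ δ :=
    (measureReal_mono (fun z => by simp only [mem_symmDiff, mem_inter_iff]; tauto)).trans hlt'
  have h4 : η.variation.real ((S \ P) ∆ (S \ R)) ≤ δ :=
    (measureReal_mono (fun z => by simp only [mem_symmDiff, mem_sdiff]; tauto)).trans hlt'
  rw [hPη S hSm, sdiff_self_inter]
  linarith [(abs_le.1 h1).2, (abs_le.1 h2).1]

variable {μ : Measure X} {ν : Measure Y} [IsProbabilityMeasure μ] [IsProbabilityMeasure ν]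

theorem rectInd_sub_ae_eq {S T : Set (X × Y)} (hS : S ∈ rectAlgebra X Y)
    (hT : T ∈ rectAlgebra X Y) :
    (rectInd μ ν S - rectInd μ ν T).1 =ᵐ[μ.prod ν] S.indicator 1 - T.indicator 1 :=
  (AEEqFun.coeFn_sub _ _).trans ((rectInd_ae_eq hS).sub (rectInd_ae_eq hT))

variable [StandardBorelSpace X] [StandardBorelSpace Y]

theorem pairing_rectInd (η : QBInfty μ ν) {S : Set (X × Y)} (hS : S ∈ rectAlgebra X Y) :
    pairing η (rectInd μ ν S) = η.1 S := by
  rw [pairing_apply_of_ae_eq η _ (properlyVirtuallyContinuous_indicator hS) (rectInd_ae_eq hS),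
    show S.indicator 1 = S.indicator fun _ => (1 : ℝ) from rfl,
    VectorMeasure.integral_indicator_const _ (measurableSet_of_mem_rectAlgebra hS)]
  simp

/-- The test function is `1` on `T` and `-1` on `S \ T`, with `T` close to the positive part of `S`;
`η` integrates it to nearly its variation on `S`. -/
theorem variation_real_le_of_norm_sub_le (η : QBInfty μ ν) {S : Set (X × Y)}
    (hS : S ∈ rectAlgebra X Y) {r : ℝ}
    (h : ∀ T ∈ rectAlgebra X Y, T ⊆ S → ‖rectInd μ ν T - rectInd μ ν (S \ T)‖ ≤ r) :
    η.1.variation.real S ≤ ‖pairing η‖ * r := by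
  refine le_of_forall_pos_le_add fun δ hδ => ?_
  obtain ⟨T, hT, hTS, hle⟩ := exists_rectAlgebra_variation_le η.1 hS (half_pos hδ)
  have hST := isSetAlgebra_rectAlgebra.sdiff_mem hS hT
  have h1 : pairing η (rectInd μ ν T - rectInd μ ν (S \ T)) = η.1 T - η.1 (S \ T) := by
    rw [map_sub, pairing_rectInd η hT, pairing_rectInd η hST]
  have h2 := (le_abs_self _).trans ((pairing η).le_opNorm (rectInd μ ν T - rectInd μ ν (S \ T)))
  have h3 := mul_le_mul_of_nonneg_left (h T hT hTS) (norm_nonneg (pairing η))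
  rw [h1] at h2
  linarith

theorem abs_indicator_sub_indicator_le {Z W : Type*} {S T : Set Z} {A : Set W} {π : Z → W}
    (hT : T ⊆ S) (h : S ⊆ π ⁻¹' A) (z : Z) :
    |(T.indicator 1 - (S \ T).indicator 1 : Z → ℝ) z| ≤ A.indicator 1 (π z) := by
  refine le_trans (le_of_eq ?_) (abs_indicator_one_le_of_subset h z)
  by_cases hz : z ∈ T
  · simp [hz, hT hz]
  · by_cases hz' : z ∈ S <;> simp [hz, hz']

/-- Over a cylinder with base `A` the test functions have norm at most the measure of `A`, so each
marginal of the variation is at most `‖pairing η‖` times `μ` or `ν`. -/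
theorem norm_le_norm_pairing (η : QBInfty μ ν) : ‖η‖ ≤ ‖pairing η‖ := by
  have key : qbNorm μ ν η.1 ≤ ENNReal.ofReal ‖pairing η‖ := by
    refine (qb_iff.2 ⟨?_, ?_⟩).2
    · refine Measure.le_iff.2 fun A hA => ?_
      have hS : Prod.fst ⁻¹' A ∈ rectAlgebra X Y := by
        rw [← prod_univ]; exact prod_mem_rectAlgebra hA .univ
      have := variation_real_le_of_norm_sub_le (r := μ.real A) η hS fun T hT hTS =>
        VC1.norm_le_of_ae_eq _
          (rectInd_sub_ae_eq hT (isSetAlgebra_rectAlgebra.sdiff_mem hS hT))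
          (srNorm_le_measure_fst hA (abs_indicator_sub_indicator_le hTS subset_rfl))
          (measure_ne_top _ _)
      rw [Measure.map_apply measurable_fst hA, Measure.smul_apply, smul_eq_mul,
        ← ofReal_measureReal, ← ofReal_measureReal (μ := μ), ← ENNReal.ofReal_mul (norm_nonneg _)]
      exact ENNReal.ofReal_le_ofReal this
    · refine Measure.le_iff.2 fun B hB => ?_
      have hS : Prod.snd ⁻¹' B ∈ rectAlgebra X Y := by
        rw [← univ_prod]; exact prod_mem_rectAlgebra .univ hB
      have := variation_real_le_of_norm_sub_le (r := ν.real B) η hS fun T hT hTS =>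
        VC1.norm_le_of_ae_eq _
          (rectInd_sub_ae_eq hT (isSetAlgebra_rectAlgebra.sdiff_mem hS hT))
          (srNorm_le_measure_snd hB (abs_indicator_sub_indicator_le hTS subset_rfl))
          (measure_ne_top _ _)
      rw [Measure.map_apply measurable_snd hB, Measure.smul_apply, smul_eq_mul,
        ← ofReal_measureReal, ← ofReal_measureReal (μ := ν), ← ENNReal.ofReal_mul (norm_nonneg _)]
      exact ENNReal.ofReal_le_ofReal this
  rw [QBInfty.norm_def]
  exact ENNReal.toReal_le_of_le_ofReal (norm_nonneg _) key

end Isometry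

/-! ### Extending contents with dominated marginals to measures -/

section Extension

open Set Topology

variable {X Y : Type*} [MeasurableSpace X] [MeasurableSpace Y]

theorem addContent_le_add_of_subset {m : AddContent ℝ≥0∞ (rectAlgebra X Y)} {R S T : Set (X × Y)}
    (hR : R ∈ rectAlgebra X Y) (hS : S ∈ rectAlgebra X Y) (hT : T ∈ rectAlgebra X Y)
    (h : R ⊆ S ∪ T) : m R ≤ m S + m T :=
  (addContent_mono isSetAlgebra_rectAlgebra.isSetRing.isSetSemiring hR
    (isSetAlgebra_rectAlgebra.union_mem hS hT) h).trans
    (addContent_union_le isSetAlgebra_rectAlgebra.isSetRing hS hT)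

/-- A set in the rectangle algebra can be approximated from inside by compact sets of the rectangle
algebra, up to arbitrarily small content. -/
def InnerCompact [TopologicalSpace X] [TopologicalSpace Y]
    (m : AddContent ℝ≥0∞ (rectAlgebra X Y)) (S : Set (X × Y)) : Prop :=
  S ∈ rectAlgebra X Y ∧ ∀ δ : ℝ≥0∞, δ ≠ 0 →
    ∃ C ∈ rectAlgebra X Y, C ⊆ S ∧ IsCompact C ∧ m (S \ C) ≤ δ

theorem InnerCompact.union [TopologicalSpace X] [TopologicalSpace Y]
    {m : AddContent ℝ≥0∞ (rectAlgebra X Y)} {S T : Set (X × Y)} (hS : InnerCompact m S)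
    (hT : InnerCompact m T) : InnerCompact m (S ∪ T) := by
  have hR := isSetAlgebra_rectAlgebra (X := X) (Y := Y)
  refine ⟨hR.union_mem hS.1 hT.1, fun δ hδ => ?_⟩
  have hδ2 : δ / 2 ≠ 0 := by simpa using hδ
  obtain ⟨C, hC, hCS, hCc, hCm⟩ := hS.2 _ hδ2
  obtain ⟨D, hD, hDT, hDc, hDm⟩ := hT.2 _ hδ2
  refine ⟨C ∪ D, hR.union_mem hC hD, union_subset_union hCS hDT, hCc.union hDc, ?_⟩
  refine (addContent_le_add_of_subset (hR.sdiff_mem (hR.union_mem hS.1 hT.1) (hR.union_mem hC hD))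
    (hR.sdiff_mem hS.1 hC) (hR.sdiff_mem hT.1 hD) (by grind)).trans ?_
  exact (add_le_add hCm hDm).trans (ENNReal.add_halves δ).le

theorem InnerCompact.inter [TopologicalSpace X] [TopologicalSpace Y] [T2Space X] [T2Space Y]
    {m : AddContent ℝ≥0∞ (rectAlgebra X Y)} {S T : Set (X × Y)} (hS : InnerCompact m S)
    (hT : InnerCompact m T) : InnerCompact m (S ∩ T) := by
  have hR := isSetAlgebra_rectAlgebra (X := X) (Y := Y)
  refine ⟨hR.inter_mem hS.1 hT.1, fun δ hδ => ?_⟩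
  have hδ2 : δ / 2 ≠ 0 := by simpa using hδ
  obtain ⟨C, hC, hCS, hCc, hCm⟩ := hS.2 _ hδ2
  obtain ⟨D, hD, hDT, hDc, hDm⟩ := hT.2 _ hδ2
  refine ⟨C ∩ D, hR.inter_mem hC hD, inter_subset_inter hCS hDT, hCc.inter hDc, ?_⟩
  refine (addContent_le_add_of_subset (hR.sdiff_mem (hR.inter_mem hS.1 hT.1) (hR.inter_mem hC hD))
    (hR.sdiff_mem hS.1 hC) (hR.sdiff_mem hT.1 hD) (by grind)).trans ?_
  exact (add_le_add hCm hDm).trans (ENNReal.add_halves δ).le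

variable {μ : Measure X} {ν : Measure Y} [IsFiniteMeasure μ] [IsFiniteMeasure ν] {c : ℝ≥0}

/-- Inner regularity is borrowed from `μ` and `ν`: what is lost in passing to `K ×ˢ L` lies over `A
\ K` or `B \ L`, where the marginal bounds control `m`. -/
theorem innerCompact_prod [TopologicalSpace X] [TopologicalSpace Y] [PolishSpace X]
    [PolishSpace Y] [BorelSpace X] [BorelSpace Y] {m : AddContent ℝ≥0∞ (rectAlgebra X Y)}
    (h1 : ∀ A, MeasurableSet A → m (Prod.fst ⁻¹' A) ≤ c * μ A)
    (h2 : ∀ B, MeasurableSet B → m (Prod.snd ⁻¹' B) ≤ c * ν B) {A : Set X} {B : Set Y}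
    (hA : MeasurableSet A) (hB : MeasurableSet B) : InnerCompact m (A ×ˢ B) := by
  have hR := isSetAlgebra_rectAlgebra (X := X) (Y := Y)
  refine ⟨prod_mem_rectAlgebra hA hB, fun δ hδ => ?_⟩
  have hδ' : δ / 2 / (c + 1) ≠ 0 := by simp [ENNReal.div_eq_zero_iff, hδ]
  have hle : ∀ t : ℝ≥0∞, t ≤ δ / 2 / (c + 1) → c * t ≤ δ / 2 := by
    intro t ht
    calc c * t ≤ (c + 1) * (δ / 2 / (c + 1)) := by gcongr; exact le_self_add
      _ ≤ δ / 2 := ENNReal.mul_div_le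
  obtain ⟨K, hKA, hK, hμ⟩ := hA.exists_isCompact_sdiff_lt (μ := μ) (measure_ne_top _ _) hδ'
  obtain ⟨L, hLB, hL, hν⟩ := hB.exists_isCompact_sdiff_lt (μ := ν) (measure_ne_top _ _) hδ'
  have hAK := hA.diff hK.measurableSet
  have hBL := hB.diff hL.measurableSet
  refine ⟨K ×ˢ L, prod_mem_rectAlgebra hK.measurableSet hL.measurableSet, prod_mono hKA hLB,
    hK.prod hL, ?_⟩
  have hm1 : Prod.fst ⁻¹' (A \ K) ∈ rectAlgebra X Y := by
    rw [← prod_univ]; exact prod_mem_rectAlgebra hAK .univ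
  have hm2 : Prod.snd ⁻¹' (B \ L) ∈ rectAlgebra X Y := by
    rw [← univ_prod]; exact prod_mem_rectAlgebra .univ hBL
  refine (addContent_le_add_of_subset (hR.sdiff_mem (prod_mem_rectAlgebra hA hB)
    (prod_mem_rectAlgebra hK.measurableSet hL.measurableSet)) hm1 hm2 ?_).trans ?_
  · rintro z ⟨⟨hz1, hz2⟩, hz⟩
    by_cases h : z.1 ∈ K
    · exact Or.inr ⟨hz2, fun h' => hz ⟨h, h'⟩⟩
    · exact Or.inl ⟨hz1, h⟩
  · calc m (Prod.fst ⁻¹' (A \ K)) + m (Prod.snd ⁻¹' (B \ L))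
        ≤ c * μ (A \ K) + c * ν (B \ L) := add_le_add (h1 _ hAK) (h2 _ hBL)
      _ ≤ δ / 2 + δ / 2 := add_le_add (hle _ hμ.le) (hle _ hν.le)
      _ = δ := ENNReal.add_halves δ

theorem innerCompact_of_mem_rectAlgebra [TopologicalSpace X] [TopologicalSpace Y] [PolishSpace X]
    [PolishSpace Y] [BorelSpace X] [BorelSpace Y] {m : AddContent ℝ≥0∞ (rectAlgebra X Y)}
    (h1 : ∀ A, MeasurableSet A → m (Prod.fst ⁻¹' A) ≤ c * μ A)
    (h2 : ∀ B, MeasurableSet B → m (Prod.snd ⁻¹' B) ≤ c * ν B) {S : Set (X × Y)}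
    (hS : S ∈ rectAlgebra X Y) : InnerCompact m S := by
  -- Compact approximation does not pass to complements directly, so the induction carries `S` and
  -- `Sᶜ` together.
  suffices InnerCompact m S ∧ InnerCompact m Sᶜ from this.1
  induction hS with
  | base S hS =>
    obtain ⟨A, hA, B, hB, rfl⟩ := hS
    refine ⟨innerCompact_prod h1 h2 hA hB, ?_⟩
    have := (innerCompact_prod h1 h2 (MeasurableSet.compl hA) .univ).union
      (innerCompact_prod h1 h2 .univ (MeasurableSet.compl hB))
    convert! this using 1
    rw [compl_prod_eq_union]
  | empty =>
    have h0 := innerCompact_prod h1 h2 MeasurableSet.empty MeasurableSet.empty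
    have h3 := innerCompact_prod h1 h2 MeasurableSet.univ MeasurableSet.univ
    rw [empty_prod] at h0
    rw [univ_prod_univ] at h3
    rw [compl_empty]
    exact ⟨h0, h3⟩
  | compl S _ h => exact ⟨h.2, by rw [compl_compl]; exact h.1⟩
  | union S T _ _ hS hT =>
    exact ⟨hS.1.union hT.1, by rw [compl_union]; exact hS.2.inter hT.2⟩

/-- The compact class argument: compact sets `C n` inside `s n`, with losses summing to less than
`δ`, have empty intersection, hence so do finitely many of them. Later sets `s n` are covered by the
corresponding finitely many losses. -/
theorem tendsto_addContent_zero [TopologicalSpace X] [TopologicalSpace Y] [T2Space X] [T2Space Y]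
    {m : AddContent ℝ≥0∞ (rectAlgebra X Y)}
    (hm : ∀ S ∈ rectAlgebra X Y, InnerCompact m S) {s : ℕ → Set (X × Y)}
    (hs : ∀ n, s n ∈ rectAlgebra X Y) (hanti : Antitone s) (hempty : ⋂ n, s n = ∅) :
    Filter.Tendsto (fun n => m (s n)) Filter.atTop (𝓝 0) := by
  have hR := isSetAlgebra_rectAlgebra (X := X) (Y := Y)
  refine ENNReal.tendsto_nhds_zero.2 fun δ hδ => ?_
  obtain ⟨e, he, hsum⟩ := ENNReal.exists_pos_sum_of_countable hδ.ne' ℕ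
  have key : ∀ n, ∃ C ∈ rectAlgebra X Y, C ⊆ s n ∧ IsCompact C ∧ m (s n \ C) ≤ e n := fun n =>
    (hm _ (hs n)).2 _ (by simpa using (he n).ne')
  choose C hC hCs hCc hCm using key
  have hCe : C 0 ∩ ⋂ n, C n = ∅ := by
    refine subset_eq_empty ?_ hempty
    exact inter_subset_right.trans (iInter_mono hCs)
  -- `C 0` is the ambient compact set, which is why the index `0` is added to `u` below.
  obtain ⟨u, hu⟩ := (hCc 0).elim_finite_subfamily_closed C (fun n => (hCc n).isClosed) hCe
  filter_upwards [Filter.eventually_ge_atTop (u.sup id)] with n hn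
  have hsub : s n ⊆ ⋃ i ∈ insert 0 u, s i \ C i := by
    intro z hz
    by_contra hcon
    simp only [mem_iUnion, not_exists] at hcon
    have hin : ∀ i ∈ insert 0 u, z ∈ C i := by
      intro i hi
      by_contra hzi
      refine hcon i hi ⟨hanti ?_ hz, hzi⟩
      rcases Finset.mem_insert.1 hi with rfl | hi
      · exact Nat.zero_le _
      · exact (Finset.le_sup (f := id) hi).trans hn
    have : z ∈ C 0 ∩ ⋂ i ∈ u, C i :=
      ⟨hin 0 (Finset.mem_insert_self _ _),
        mem_iInter₂.2 fun i hi => hin i (Finset.mem_insert_of_mem hi)⟩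
    rw [hu] at this
    exact this
  have hmem : ∀ i ∈ insert 0 u, s i \ C i ∈ rectAlgebra X Y := fun i _ => hR.sdiff_mem (hs i) (hC i)
  calc m (s n) ≤ m (⋃ i ∈ insert 0 u, s i \ C i) :=
        addContent_mono hR.isSetRing.isSetSemiring (hs n) (hR.biUnion_mem _ hmem) hsub
    _ ≤ ∑ i ∈ insert 0 u, m (s i \ C i) := addContent_biUnion_le hR.isSetRing hmem
    _ ≤ ∑ i ∈ insert 0 u, (e i : ℝ≥0∞) := Finset.sum_le_sum fun i _ => hCm i
    _ ≤ ∑' i, (e i : ℝ≥0∞) := ENNReal.sum_le_tsum _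
    _ ≤ δ := hsum.le

/-- A finitely additive content on the rectangle algebra of standard Borel spaces whose marginals
are dominated by finite measures extends to a measure. -/
theorem exists_measure_eq_addContent [StandardBorelSpace X] [StandardBorelSpace Y]
    (m : AddContent ℝ≥0∞ (rectAlgebra X Y))
    (h1 : ∀ A, MeasurableSet A → m (Prod.fst ⁻¹' A) ≤ c * μ A)
    (h2 : ∀ B, MeasurableSet B → m (Prod.snd ⁻¹' B) ≤ c * ν B) :
    ∃ κ : Measure (X × Y), ∀ S ∈ rectAlgebra X Y, κ S = m S := by
  let := upgradeStandardBorel X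
  let := upgradeStandardBorel Y
  have hR := isSetAlgebra_rectAlgebra (X := X) (Y := Y)
  have hfin : ∀ S ∈ rectAlgebra X Y, m S ≠ ∞ := by
    intro S hS
    refine ne_top_of_le_ne_top ?_ ((addContent_mono hR.isSetRing.isSetSemiring hS hR.univ_mem
      (subset_univ S)).trans (h1 univ .univ))
    exact ENNReal.mul_ne_top ENNReal.coe_ne_top (measure_ne_top _ _)
  -- For a finite content, continuity at the empty set gives countable additivity, and Carathéodory
  -- extension applies.
  have hsub : m.IsSigmaSubadditive :=
    isSigmaSubadditive_of_addContent_iUnion_eq_tsum hR.isSetRing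
      (addContent_iUnion_eq_sum_of_tendsto_zero hR.isSetRing m hfin fun s hs hanti hempty =>
        tendsto_addContent_zero (fun S hS => innerCompact_of_mem_rectAlgebra h1 h2 hS) hs hanti
          hempty)
  exact ⟨m.measure hR.isSetRing.isSetSemiring generateFrom_rectAlgebra.le hsub, fun S hS =>
    m.measure_eq hR.isSetRing.isSetSemiring generateFrom_rectAlgebra hsub hS⟩

end Extension

/-! ### Representation of functionals on `VC¹` -/

section Representation

open Set Topology

variable {X Y : Type*} [MeasurableSpace X] [MeasurableSpace Y]
  {μ : Measure X} {ν : Measure Y} [IsProbabilityMeasure μ] [IsProbabilityMeasure ν]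

theorem apply_rectInd_union (Λ : StrongDual ℝ (VC1 μ ν)) {S T : Set (X × Y)}
    (hS : S ∈ rectAlgebra X Y) (hT : T ∈ rectAlgebra X Y) (h : Disjoint S T) :
    Λ (rectInd μ ν (S ∪ T)) = Λ (rectInd μ ν S) + Λ (rectInd μ ν T) := by
  rw [rectInd_union hS hT h, map_add]

/-- The positive variation of a functional, as a function of sets. -/
noncomputable def posVar (Λ : StrongDual ℝ (VC1 μ ν)) (S : Set (X × Y)) : ℝ≥0∞ :=
  ⨆ (T : Set (X × Y)) (_ : T ∈ rectAlgebra X Y ∧ T ⊆ S), ENNReal.ofReal (Λ (rectInd μ ν T))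

theorem le_posVar (Λ : StrongDual ℝ (VC1 μ ν)) {S T : Set (X × Y)} (hT : T ∈ rectAlgebra X Y)
    (h : T ⊆ S) : ENNReal.ofReal (Λ (rectInd μ ν T)) ≤ posVar Λ S :=
  le_iSup₂_of_le T ⟨hT, h⟩ le_rfl

theorem posVar_union (Λ : StrongDual ℝ (VC1 μ ν)) {S T : Set (X × Y)}
    (hS : S ∈ rectAlgebra X Y) (hT : T ∈ rectAlgebra X Y) (h : Disjoint S T) :
    posVar Λ (S ∪ T) = posVar Λ S + posVar Λ T := by
  have hR := isSetAlgebra_rectAlgebra (X := X) (Y := Y)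
  refine le_antisymm (iSup₂_le ?_) ?_
  · rintro U ⟨hU, hUST⟩
    have hUS := hR.inter_mem hU hS
    have hUT := hR.inter_mem hU hT
    have : U = U ∩ S ∪ U ∩ T := by rw [← inter_union_distrib_left, inter_eq_left.2 hUST]
    rw [this, apply_rectInd_union Λ hUS hUT (h.mono inter_subset_right inter_subset_right)]
    exact ENNReal.ofReal_add_le.trans
      (add_le_add (le_posVar Λ hUS inter_subset_right) (le_posVar Λ hUT inter_subset_right))
  · refine ENNReal.biSup_add_biSup_le' ⟨∅, hR.empty_mem, empty_subset _⟩
      ⟨∅, hR.empty_mem, empty_subset _⟩ ?_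
    rintro U ⟨hU, hUS⟩ V ⟨hV, hVT⟩
    -- A competitor with nonpositive value contributes zero and may be dropped; two nonnegative ones
    -- are glued, by disjointness.
    rcases le_total (Λ (rectInd μ ν U)) 0 with h1 | h1
    · rw [ENNReal.ofReal_of_nonpos h1, zero_add]
      exact le_posVar Λ hV (hVT.trans subset_union_right)
    rcases le_total (Λ (rectInd μ ν V)) 0 with h2 | h2
    · rw [ENNReal.ofReal_of_nonpos h2, add_zero]
      exact le_posVar Λ hU (hUS.trans subset_union_left)
    rw [← ENNReal.ofReal_add h1 h2, ← apply_rectInd_union Λ hU hV (h.mono hUS hVT)]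
    exact le_posVar Λ (hR.union_mem hU hV) (union_subset_union hUS hVT)

theorem posVar_empty (Λ : StrongDual ℝ (VC1 μ ν)) : posVar Λ ∅ = 0 := by
  refine le_antisymm (iSup₂_le ?_) zero_le
  rintro T ⟨-, hT⟩
  rw [subset_empty_iff.1 hT, rectInd_empty, map_zero, ENNReal.ofReal_zero]

theorem posVar_le (Λ : StrongDual ℝ (VC1 μ ν)) {S : Set (X × Y)} {r : ℝ≥0∞} (hr : r ≠ ∞)
    (h : ∀ T ∈ rectAlgebra X Y, T ⊆ S → ‖rectInd μ ν T‖ ≤ r.toReal) :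
    posVar Λ S ≤ ‖Λ‖₊ * r := by
  refine iSup₂_le ?_
  rintro T ⟨hT, hTS⟩
  calc ENNReal.ofReal (Λ (rectInd μ ν T)) ≤ ENNReal.ofReal (‖Λ‖ * r.toReal) := by
        refine ENNReal.ofReal_le_ofReal ((le_abs_self _).trans ((Λ.le_opNorm _).trans ?_))
        exact mul_le_mul_of_nonneg_left (h T hT hTS) (norm_nonneg _)
    _ = ‖Λ‖₊ * r := by
        rw [ENNReal.ofReal_mul (norm_nonneg _), ENNReal.ofReal_toReal hr, ofReal_norm]
        rfl

theorem posVar_fst_le (Λ : StrongDual ℝ (VC1 μ ν)) {A : Set X} (hA : MeasurableSet A) :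
    posVar Λ (Prod.fst ⁻¹' A) ≤ ‖Λ‖₊ * μ A :=
  posVar_le Λ (measure_ne_top _ _) fun _ hT hTA => norm_rectInd_le_fst hT hA hTA

theorem posVar_snd_le (Λ : StrongDual ℝ (VC1 μ ν)) {B : Set Y} (hB : MeasurableSet B) :
    posVar Λ (Prod.snd ⁻¹' B) ≤ ‖Λ‖₊ * ν B :=
  posVar_le Λ (measure_ne_top _ _) fun _ hT hTB => norm_rectInd_le_snd hT hB hTB

variable [StandardBorelSpace X] [StandardBorelSpace Y]

theorem exists_measure_eq_posVar (Λ : StrongDual ℝ (VC1 μ ν)) :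
    ∃ κ : Measure (X × Y), (∀ S ∈ rectAlgebra X Y, κ S = posVar Λ S) ∧
      κ.map Prod.fst ≤ (‖Λ‖₊ : ℝ≥0∞) • μ ∧ κ.map Prod.snd ≤ (‖Λ‖₊ : ℝ≥0∞) • ν := by
  let m : AddContent ℝ≥0∞ (rectAlgebra X Y) :=
    isSetAlgebra_rectAlgebra.isSetRing.addContent_of_union (posVar Λ) (posVar_empty Λ) (posVar_union Λ)
  obtain ⟨κ, hκ⟩ := exists_measure_eq_addContent (μ := μ) (ν := ν) (c := ‖Λ‖₊) m
    (fun A hA => posVar_fst_le Λ hA) (fun B hB => posVar_snd_le Λ hB)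
  refine ⟨κ, hκ, Measure.le_iff.2 fun A hA => ?_, Measure.le_iff.2 fun B hB => ?_⟩
  · have hS : Prod.fst ⁻¹' A ∈ rectAlgebra X Y := by
      rw [← prod_univ]; exact prod_mem_rectAlgebra hA .univ
    rw [Measure.map_apply measurable_fst hA, hκ _ hS]
    exact posVar_fst_le Λ hA
  · have hS : Prod.snd ⁻¹' B ∈ rectAlgebra X Y := by
      rw [← univ_prod]; exact prod_mem_rectAlgebra .univ hB
    rw [Measure.map_apply measurable_snd hB, hκ _ hS]
    exact posVar_snd_le Λ hB

theorem pairing_surjective : Function.Surjective (pairing (μ := μ) (ν := ν)) := by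
  intro Λ
  have hR := isSetAlgebra_rectAlgebra (X := X) (Y := Y)
  obtain ⟨κ, hκ, hκ1, hκ2⟩ := exists_measure_eq_posVar Λ
  obtain ⟨κ', hκ', hκ1', hκ2'⟩ := exists_measure_eq_posVar (-Λ)
  have hfin : IsFiniteMeasure (κ + κ') := by
    refine ⟨?_⟩
    rw [Measure.add_apply, hκ _ hR.univ_mem, hκ' _ hR.univ_mem]
    refine ENNReal.add_lt_top.2 ⟨(posVar_fst_le Λ .univ).trans_lt ?_,
      (posVar_fst_le (-Λ) .univ).trans_lt ?_⟩ <;>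
    exact ENNReal.mul_lt_top ENNReal.coe_lt_top (measure_lt_top _ _)
  let m : AddContent ℝ (rectAlgebra X Y) := hR.isSetRing.addContent_of_union
    (fun S => Λ (rectInd μ ν S)) (by rw [rectInd_empty, map_zero]) (apply_rectInd_union Λ)
  -- Nonnegative values of `Λ` are bounded by its positive variation `κ`, nonpositive ones by that
  -- of `-Λ`, namely `κ'`.
  have hm : ∀ S ∈ rectAlgebra X Y, ‖m S‖ₑ ≤ (κ + κ') S := by
    intro S hS
    rw [Measure.add_apply, hκ S hS, hκ' S hS]
    change ‖Λ (rectInd μ ν S)‖ₑ ≤ _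
    rcases le_total 0 (Λ (rectInd μ ν S)) with h | h
    · rw [Real.enorm_of_nonneg h]
      exact (le_posVar Λ hS subset_rfl).trans le_self_add
    · rw [← enorm_neg, Real.enorm_of_nonneg (neg_nonneg.2 h)]
      exact (le_posVar (-Λ) hS subset_rfl).trans le_add_self
  obtain ⟨η, hη, hηκ⟩ :=
    VectorMeasure.exists_extension_of_isSetSemiring_of_le_measure_of_generateFrom
      hR.isSetRing.isSetSemiring hm generateFrom_rectAlgebra
  have hvar : η.variation ≤ κ + κ' :=
    VectorMeasure.variation_le_of_forall_enorm_le fun S _ => hηκ S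
  -- The crude factor two is harmless: only membership in `QBInfty` is needed, and the sharp norm
  -- comes from the isometry.
  have hqb : IsQuasiBistochastic μ ν η ∧ qbNorm μ ν η ≤ (‖Λ‖₊ : ℝ≥0∞) + ‖-Λ‖₊ := by
    refine qb_iff.2 ⟨(Measure.map_mono hvar measurable_fst).trans ?_,
      (Measure.map_mono hvar measurable_snd).trans ?_⟩
    · rw [Measure.map_add _ _ measurable_fst, add_smul]
      exact add_le_add hκ1 hκ1'
    · rw [Measure.map_add _ _ measurable_snd, add_smul]
      exact add_le_add hκ2 hκ2'
  let ξ : QBInfty μ ν := ⟨η, hqb.1, hqb.2.trans_lt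
    (ENNReal.add_lt_top.2 ⟨ENNReal.coe_lt_top, ENNReal.coe_lt_top⟩)⟩
  refine ⟨ξ, ContinuousLinearMap.ext_on dense_span_rectInd ?_⟩
  rintro _ ⟨S, hS, rfl⟩
  rw [pairing_rectInd ξ hS]
  exact hη S hS

end Representation

theorem mainTheorem1 {X Y : Type*} [MeasurableSpace X] [StandardBorelSpace X]
    [MeasurableSpace Y] [StandardBorelSpace Y] (μ : Measure X) (ν : Measure Y)
    [IsProbabilityMeasure μ] [IsProbabilityMeasure ν] :
    ∃ Φ : QBInfty μ ν ≃ₗᵢ[ℝ] StrongDual ℝ (VC1 μ ν),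
      ∀ (η : QBInfty μ ν) (f : VC1 μ ν) (f' : X × Y → ℝ),
        ProperlyVirtuallyContinuous μ ν f' →
        (f : X × Y →ₘ[μ.prod ν] ℝ) =ᵐ[μ.prod ν] f' →
        (η : SignedMeasure (X × Y)).Integrable f' ∧
          Φ η f = ∫ᵛ z, f' z ∂•(η : SignedMeasure (X × Y)) := by
  let Ψ : QBInfty μ ν →ₗᵢ[ℝ] StrongDual ℝ (VC1 μ ν) :=
    ⟨pairing, fun η => le_antisymm (norm_pairing_le η) (norm_le_norm_pairing η)⟩
  refine ⟨LinearIsometryEquiv.ofSurjective Ψ pairing_surjective, fun η f f' hf' h => ⟨?_, ?_⟩⟩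
  · refine QBInfty.integrable η hf' ?_
    rw [VC1.srNorm_eq_of_ae_eq f h]
    exact ENNReal.ofReal_ne_top
  · exact pairing_apply_of_ae_eq η f hf' h
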